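/- A composition is a sequence $\alpha=(\alpha_1,\alpha_2,\dots)$ of nonnegative integers, almost all zero; $\alpha^+$ is the partition obtained by sorting $\alpha$, and a permutation $w$ in $S_+=\bigcup_n S_n$ acts by $(w\alpha)_{w(i)}=\alpha_i$. In $\mathbb{Z}[\beta][x_1,x_2,\dots]$ let $s_i$ exchange $x_i$ and $x_{i+1}$ and put $$\pi_i^{(\beta)}f=\frac{g-s_i g}{x_i-x_{i+1}},\qquad g=(1+\beta x_{i+1})\,x_i f .$$ The Lascoux polynomials are defined by $\mathfrak{L}^{(\beta)}_\alpha=x^\alpha$ if $\alpha$ is a partition and $\mathfrak{L}^{(\beta)}_\alpha=\pi_i^{(\beta)}\mathfrak{L}^{(\beta)}_{s_i\alpha}$ whenever $\alpha_i<\alpha_{i+1}$. A reverse semistandard tableau has positive integer entries weakly decreasing along rows and strictly decreasing down columns. A reverse set-valued tableau $T$ of shape $\lambda$ fills each box $s$ of the partition $\lambda$ with a finite nonempty set $T(s)$ of positive integers such that $\min T(s)\ge\max T(t)$ if $t$ is immediately right of $s$, and $\min T(s)>\max T(t)$ if $t$ is immediately below $s$. Let $\mathrm{wt}(T)_i$ be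 the number of boxes whose set contains $i$, let $\mathrm{ex}(T)=|\mathrm{wt}(T)|-|\lambda|$, where $|\cdot|$ is the sum of the parts, and let $L(T)$ be the reverse semistandard tableau obtained by replacing each $T(s)$ by $\max T(s)$. For columns $C_1$ and $C_2=\{a_1<\dots<a_m\}$ forming a reverse semistandard tableau $C_1C_2$, let $C_1\triangleleft C_2=\{b_1<\dots<b_m\}$, where $b_r$ is the smallest element of $C_1$ with $b_r\ge a_r$ and (if $r>1$) $b_r>b_{r-1}$. The left key $K_-(S)$ of a reverse semistandard tableau $S$ with columns $C_1,C_2,\dots$ is the composition whose $i$-th part is the number of $k$ with $i\in C_1\triangleleft(C_2\triangleleft(\cdots\triangleleft C_k))$. For compositions write $\gamma\le\alpha$ if there are a partition $\nu$ and $u\le v$ in the Bruhat order of $S_+$ with $u\nu=\gamma$ and $v\nu=\alpha$ (the quotient of Bruhat order on the orbit $S_+\alpha$). **Theorem.** For every composition $\alpha$, the set of reverse set-valued tableaux $T$ of shape $\alpha^+$ with $K_-(L(T))\le\alpha$ is finite, and $$\mathfrak{L}^{(\beta)}_\alpha=\sum_{T}\beta^{\mathrm{ex}(T)}x^{\mathrm{wt}(T)},$$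 where $T$ runs over this set. -/

import Mathlib

/-!  Conventions.  Positions, variables and tableau entries, which are positive integers in the usual
notation, are indexed by `ℕ` here: the natural number `k` stands for the positive integer `k + 1`
(so `X k` is the variable `x_{k+1}`).  Rows and columns of diagrams also start at `0`. -/

namespace Lascoux

open MvPolynomial

/-- The ring `ℤ[β][x₁, x₂, …]`. -/
abbrev R : Type := MvPolynomial ℕ (Polynomial ℤ)

/-- The parameter `β`. -/
noncomputable def beta : R := C Polynomial.X

/-- The action of `s_i` on `R`, exchanging the variables `X i` and `X (i + 1)`. -/
noncomputable def sPoly (i : ℕ) : R →ₐ[Polynomial ℤ] R := rename (Equiv.swap i (i + 1))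

theorem sub_dvd_sub_sPoly (i : ℕ) (f : R) : (X i - X (i + 1) : R) ∣ f - sPoly i f := by
  induction f using MvPolynomial.induction_on with
  | C a => simp [sPoly]
  | add p q hp hq =>
    have := dvd_add hp hq
    rw [map_add]
    convert this using 1
    ring
  | mul_X p k hp =>
    have h2 : (X i - X (i + 1) : R) ∣ X k - X (Equiv.swap i (i + 1) k) := by
      by_cases h : k = i
      · subst h
        simp
      · by_cases h' : k = i + 1
        · subst h'
          rw [Equiv.swap_apply_right]
          exact ⟨-1, by ring⟩
        · rw [Equiv.swap_apply_of_ne_of_ne h h']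
          simp
    have h3 : p * X k - sPoly i (p * X k)
        = (p - sPoly i p) * X k + sPoly i p * (X k - X (Equiv.swap i (i + 1) k)) := by
      rw [map_mul]
      simp only [sPoly, rename_X]
      ring
    rw [h3]
    exact dvd_add (Dvd.dvd.mul_right hp _) (Dvd.dvd.mul_left h2 _)

/-- The divided difference `∂_i f = (x_i - x_{i+1})⁻¹ (f - s_i f)`: the quotient, which exists in `R`
by `sub_dvd_sub_sPoly` and is unique because `R` is a domain. -/
noncomputable def divDiff (i : ℕ) (f : R) : R := Classical.choose (sub_dvd_sub_sPoly i f)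

theorem divDiff_spec (i : ℕ) (f : R) :
    (X i - X (i + 1) : R) * divDiff i f = f - sPoly i f :=
  (Classical.choose_spec (sub_dvd_sub_sPoly i f)).symm

/-- The operator `π_i^{(β)} = ∂_i (1 + β x_{i+1}) x_i`. -/
noncomputable def piBeta (i : ℕ) (f : R) : R :=
  divDiff i ((1 + beta * X (i + 1)) * (X i * f))

/-- A (weak) composition: a sequence of natural numbers, almost all zero. -/
abbrev Comp : Type := ℕ →₀ ℕ

/-- The action of a permutation on a composition by permuting positions: `(w α)_{w i} = α_i`. -/
noncomputable def act (w : Equiv.Perm ℕ) (α : Comp) : Comp := Finsupp.equivMapDomain w α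

/-- The composition `s_i α`. -/
noncomputable def sComp (i : ℕ) (α : Comp) : Comp := act (Equiv.swap i (i + 1)) α

/-- A composition is a partition if it is weakly decreasing. -/
def IsPartition (α : Comp) : Prop := Antitone (α : ℕ → ℕ)

theorem sComp_apply (i : ℕ) (α : Comp) (k : ℕ) : sComp i α k = α (Equiv.swap i (i + 1) k) := by
  simp [sComp, act, Finsupp.equivMapDomain_apply]

theorem sComp_left (i : ℕ) (α : Comp) : sComp i α i = α (i + 1) := by simp [sComp_apply]

theorem sComp_right (i : ℕ) (α : Comp) : sComp i α (i + 1) = α i := by simp [sComp_apply]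

theorem sComp_of_ne {i k : ℕ} (α : Comp) (h : k ≠ i) (h' : k ≠ i + 1) : sComp i α k = α k := by
  rw [sComp_apply, Equiv.swap_apply_of_ne_of_ne h h']

/-- The quantity `∑ i α_i`, which drops when an ascent of `α` is removed. -/
def moment (α : Comp) : ℕ := α.sum fun i a => i * a

theorem moment_sComp_lt {i : ℕ} {α : Comp} (h : α i < α (i + 1)) :
    moment (sComp i α) < moment α := by
  have e : ∀ γ : Comp, (∀ k, α k = 0 → k ≠ i → k ≠ i + 1 → γ k = 0) →
      moment γ = ∑ k ∈ (α.support \ {i, i + 1}), k * γ k + (i * γ i + (i + 1) * γ (i + 1)) := by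
    intro γ hγ
    have h1 : γ.support ⊆ (α.support \ {i, i + 1}) ∪ {i, i + 1} := by
      intro k hk
      by_contra hc
      simp only [Finset.mem_union, Finset.mem_sdiff, Finset.mem_insert, Finset.mem_singleton,
        Finsupp.mem_support_iff] at hc hk
      refine hk (hγ k ?_ ?_ ?_) <;> tauto
    rw [moment, Finsupp.sum_of_support_subset _ h1 _ (by simp),
      Finset.sum_union Finset.sdiff_disjoint, Finset.sum_pair (by omega)]
  rw [e α (fun k hk _ _ => hk), e (sComp i α) (fun k hk h1 h2 => by rw [sComp_of_ne α h1 h2, hk]),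
    sComp_left, sComp_right]
  have : ∑ k ∈ (α.support \ {i, i + 1}), k * sComp i α k
      = ∑ k ∈ (α.support \ {i, i + 1}), k * α k := by
    refine Finset.sum_congr rfl fun k hk => ?_
    simp only [Finset.mem_sdiff, Finset.mem_insert, Finset.mem_singleton, not_or] at hk
    rw [sComp_of_ne α hk.2.1 hk.2.2]
  rw [this]
  nlinarith

/-- The Lascoux polynomial `𝔏_α^{(β)}`: it is `x^α` if `α` has no ascent, that is, if `α` is a
partition, and `π_i^{(β)} 𝔏_{s_i α}^{(β)}` for an ascent `i` of `α` otherwise.  The definition uses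
the first ascent; by `lascoux_of_ascent` the same recursion holds at every ascent. -/
noncomputable def lascoux (α : Comp) : R :=
  open Classical in
  if h : ∃ i, α i < α (i + 1) then
    piBeta (Nat.find h) (lascoux (sComp (Nat.find h) α))
  else monomial α 1
termination_by moment α
decreasing_by exact moment_sComp_lt (Nat.find_spec h)

theorem lascoux_of_isPartition {α : Comp} (h : IsPartition α) : lascoux α = monomial α 1 := by
  rw [lascoux, dif_neg]
  rintro ⟨i, hi⟩
  exact absurd (h (Nat.le_succ i)) (not_le.mpr hi)

theorem X_sub_X_ne_zero {i j : ℕ} (h : i ≠ j) : (X i - X j : R) ≠ 0 :=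
  sub_ne_zero.mpr fun hh => h (X_injective hh)

theorem piBeta_spec (i : ℕ) (f : R) :
    (X i - X (i + 1) : R) * piBeta i f
      = (1 + beta * X (i + 1)) * X i * f - (1 + beta * X i) * X (i + 1) * sPoly i f := by
  rw [piBeta, divDiff_spec]
  simp only [map_mul, map_add, map_one]
  have h1 : sPoly i beta = beta := by simp [sPoly, beta]
  have h2 : sPoly i (X i) = X (i + 1) := by simp [sPoly]
  have h3 : sPoly i (X (i + 1)) = X i := by simp [sPoly]
  rw [h1, h2, h3]
  ring

theorem sPoly_X_of_ne {i k : ℕ} (h : k ≠ i) (h' : k ≠ i + 1) : sPoly i (X k) = X k := by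
  rw [sPoly, rename_X, Equiv.swap_apply_of_ne_of_ne h h']

theorem sPoly_X_left (i : ℕ) : sPoly i (X i) = X (i + 1) := by simp [sPoly]

theorem sPoly_X_right (i : ℕ) : sPoly i (X (i + 1)) = X i := by simp [sPoly]

theorem sPoly_beta (i : ℕ) : sPoly i beta = beta := by simp [sPoly, beta]

theorem sPoly_sPoly (i : ℕ) (f : R) : sPoly i (sPoly i f) = f := by
  simp only [sPoly, rename_rename]
  have : (Equiv.swap i (i + 1) : ℕ → ℕ) ∘ (Equiv.swap i (i + 1)) = id := by
    funext k
    simp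
  rw [this, rename_id_apply]

theorem sPoly_comm {i j : ℕ} (h : i + 1 < j) (f : R) :
    sPoly i (sPoly j f) = sPoly j (sPoly i f) := by
  simp only [sPoly, rename_rename]
  congr 2
  funext k
  simp only [Function.comp, Equiv.swap_apply_def]
  grind

theorem sPoly_braid (i : ℕ) (f : R) :
    sPoly i (sPoly (i + 1) (sPoly i f)) = sPoly (i + 1) (sPoly i (sPoly (i + 1) f)) := by
  simp only [sPoly, rename_rename]
  congr 2
  funext k
  simp only [Function.comp, Equiv.swap_apply_def]
  grind

theorem piBeta_comm {i j : ℕ} (h : i + 1 < j) (f : R) :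
    piBeta i (piBeta j f) = piBeta j (piBeta i f) := by
  have ei := piBeta_spec i f
  have ej := piBeta_spec j f
  have eij := piBeta_spec i (piBeta j f)
  have eji := piBeta_spec j (piBeta i f)
  have sj := congrArg (sPoly j) ei
  have si := congrArg (sPoly i) ej
  have a1 := sPoly_X_of_ne (i := j) (k := i) (by omega) (by omega)
  have a2 := sPoly_X_of_ne (i := j) (k := i + 1) (by omega) (by omega)
  have a3 := sPoly_X_of_ne (i := i) (k := j) (by omega) (by omega)
  have a4 := sPoly_X_of_ne (i := i) (k := j + 1) (by omega) (by omega)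
  simp only [map_mul, map_add, map_sub, map_one, sPoly_beta, a1, a2] at sj
  simp only [map_mul, map_add, map_sub, map_one, sPoly_beta, a3, a4, sPoly_comm h] at si
  refine mul_left_cancel₀ (mul_ne_zero (X_sub_X_ne_zero (i := i) (j := i + 1) (by omega))
    (X_sub_X_ne_zero (i := j) (j := j + 1) (by omega))) ?_
  linear_combination (X j - X (j + 1)) * eij - (X i - X (i + 1)) * eji
    + (1 + beta * X (i + 1)) * X i * ej - (1 + beta * X i) * X (i + 1) * si
    - (1 + beta * X (j + 1)) * X j * ei + (1 + beta * X j) * X (j + 1) * sj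

theorem piBeta_braid (i : ℕ) (f : R) :
    piBeta i (piBeta (i + 1) (piBeta i f)) = piBeta (i + 1) (piBeta i (piBeta (i + 1) f)) := by
  have b1 := sPoly_X_of_ne (i := i) (k := i + 1 + 1) (by omega) (by omega)
  have b2 := sPoly_X_of_ne (i := i + 1) (k := i) (by omega) (by omega)
  have l1 := sPoly_X_left i
  have r1 := sPoly_X_right i
  have l2 := sPoly_X_left (i + 1)
  have r2 := sPoly_X_right (i + 1)
  have br := sPoly_braid i f
  have n1 := X_sub_X_ne_zero (i := i) (j := i + 1) (by omega)
  have n2 := X_sub_X_ne_zero (i := i + 1) (j := i + 1 + 1) (by omega)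
  have n3 := X_sub_X_ne_zero (i := i) (j := i + 1 + 1) (by omega)
  have p0 := piBeta_spec i f
  have p1 := congrArg (sPoly i) p0
  have p2 := congrArg (sPoly (i + 1)) p0
  have p12 := congrArg (sPoly i) p2
  have q0 := piBeta_spec (i + 1) (piBeta i f)
  have q1 := congrArg (sPoly i) q0
  have r0 := piBeta_spec i (piBeta (i + 1) (piBeta i f))
  have u0 := piBeta_spec (i + 1) f
  have u1 := congrArg (sPoly i) u0
  have u2 := congrArg (sPoly (i + 1)) u0
  have u21 := congrArg (sPoly (i + 1)) u1
  have v0 := piBeta_spec i (piBeta (i + 1) f)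
  have v2 := congrArg (sPoly (i + 1)) v0
  have w0 := piBeta_spec (i + 1) (piBeta i (piBeta (i + 1) f))
  simp only [map_mul, map_add, map_sub, map_one, sPoly_beta, b1, b2, l1, r1, l2, r2,
    sPoly_sPoly] at p1 p2 p12 q1 u1 u2 u21 v2
  rw [← br] at u21
  generalize (X i : R) = a at *
  generalize (X (i + 1) : R) = b at *
  generalize (X (i + 1 + 1) : R) = c at *
  generalize (beta : R) = t at *
  refine mul_left_cancel₀ (mul_ne_zero (mul_ne_zero (pow_ne_zero 2 n1) (pow_ne_zero 2 n2)) n3) ?_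
  linear_combination
    (a - b) * (b - c) ^ 2 * (a - c) * r0
    + (1 + t * b) * a * (a - b) * (b - c) * (a - c) * q0
    - (1 + t * a) * b * (a - b) * (b - c) ^ 2 * q1
    + (1 + t * b) * a * ((1 + t * c) * b) * (b - c) * (a - c) * p0
    - (1 + t * b) * a * ((1 + t * b) * c) * (a - b) * (b - c) * p2
    + (1 + t * a) * b * ((1 + t * c) * a) * (b - c) ^ 2 * p1
    + (1 + t * a) * b * ((1 + t * a) * c) * (a - b) * (b - c) * p12
    - (a - b) ^ 2 * (b - c) * (a - c) * w0
    - (1 + t * c) * b * (a - b) * (b - c) * (a - c) * v0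
    + (1 + t * b) * c * (a - b) ^ 2 * (b - c) * v2
    - (1 + t * c) * b * ((1 + t * b) * a) * (a - b) * (a - c) * u0
    + (1 + t * c) * b * ((1 + t * a) * b) * (a - b) * (b - c) * u1
    - (1 + t * b) * c * ((1 + t * c) * a) * (a - b) ^ 2 * u2
    - (1 + t * b) * c * ((1 + t * a) * c) * (a - b) * (b - c) * u21

theorem sComp_comm {i j : ℕ} (h : i + 1 < j) (α : Comp) :
    sComp i (sComp j α) = sComp j (sComp i α) := by
  ext k
  simp only [sComp_apply, Equiv.swap_apply_def]
  congr 1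
  grind

theorem sComp_braid (i : ℕ) (α : Comp) :
    sComp i (sComp (i + 1) (sComp i α)) = sComp (i + 1) (sComp i (sComp (i + 1) α)) := by
  ext k
  simp only [sComp_apply, Equiv.swap_apply_def]
  congr 1
  grind

theorem lascoux_of_ascent_aux (n : ℕ) : ∀ α : Comp, moment α < n →
    ∀ i, α i < α (i + 1) → lascoux α = piBeta i (lascoux (sComp i α)) := by
  induction n with
  | zero => intro α h; omega
  | succ n ih =>
    intro α hn
    have key : ∀ i j, i < j → α i < α (i + 1) → α j < α (j + 1) →
        piBeta i (lascoux (sComp i α)) = piBeta j (lascoux (sComp j α)) := by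
      intro i j hij hi hj
      have hmi := moment_sComp_lt hi
      have hmj := moment_sComp_lt hj
      rcases Nat.lt_or_ge (i + 1) j with h | h
      · rw [ih (sComp i α) (by omega) j, ih (sComp j α) (by omega) i, sComp_comm h,
          piBeta_comm h]
        · rwa [sComp_of_ne α (by omega) (by omega), sComp_of_ne α (by omega) (by omega)]
        · rwa [sComp_of_ne α (by omega) (by omega), sComp_of_ne α (by omega) (by omega)]
      · obtain rfl : j = i + 1 := by omega
        have a1 : sComp i α (i + 1) < sComp i α (i + 1 + 1) := by
          rw [sComp_right, sComp_of_ne α (by omega) (by omega)]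
          omega
        have a2 : sComp (i + 1) (sComp i α) i < sComp (i + 1) (sComp i α) (i + 1) := by
          rw [sComp_left, sComp_of_ne _ (by omega) (by omega), sComp_left,
            sComp_of_ne α (by omega) (by omega)]
          omega
        have b1 : sComp (i + 1) α i < sComp (i + 1) α (i + 1) := by
          rw [sComp_left, sComp_of_ne α (by omega) (by omega)]
          omega
        have b2 : sComp i (sComp (i + 1) α) (i + 1) < sComp i (sComp (i + 1) α) (i + 1 + 1) := by
          rw [sComp_right, sComp_of_ne α (k := i) (by omega) (by omega),
            sComp_of_ne _ (k := i + 1 + 1) (by omega) (by omega), sComp_right]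
          omega
        have ma := moment_sComp_lt a1
        have mb := moment_sComp_lt b1
        rw [ih _ (by omega) _ a1, ih _ (by omega) _ a2, ih _ (by omega) _ b1,
          ih _ (by omega) _ b2, sComp_braid, piBeta_braid]
    intro i hi
    classical
    have hex : ∃ i, α i < α (i + 1) := ⟨i, hi⟩
    have h0 : lascoux α = piBeta (Nat.find hex) (lascoux (sComp (Nat.find hex) α)) := by
      rw [lascoux, dif_pos hex]
    have hf := Nat.find_spec hex
    rw [h0]
    rcases lt_trichotomy (Nat.find hex) i with h | h | h
    · exact key _ _ h hf hi
    · rw [h]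
    · exact (key _ _ h hi hf).symm

/-- The defining recursion of the Lascoux polynomials holds at every ascent. -/
theorem lascoux_of_ascent {α : Comp} {i : ℕ} (h : α i < α (i + 1)) :
    lascoux α = piBeta i (lascoux (sComp i α)) :=
  lascoux_of_ascent_aux _ α (Nat.lt_succ_self _) i h

/-! ### Bruhat order -/

/-- Membership in `S_+`, the permutations that move only finitely many letters. -/
def IsFinitary (w : Equiv.Perm ℕ) : Prop := {k | w k ≠ k}.Finite

/-- The strong Bruhat order on permutations: the reflexive transitive closure of `u < u t` for
transpositions `t = (a b)` that increase the length, that is, `a < b` and `u a < u b`. -/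
def BruhatLE : Equiv.Perm ℕ → Equiv.Perm ℕ → Prop :=
  Relation.ReflTransGen fun u v => ∃ a b, a < b ∧ u a < u b ∧ v = u * Equiv.swap a b

/-- The order on an orbit of `S_+` on compositions induced by Bruhat order, the orbit of a
partition `ν` being the quotient of `S_+` by the stabilizer of `ν` via `w ↦ w ν`. -/
def CompLE (γ α : Comp) : Prop :=
  ∃ (ν : Comp) (u v : Equiv.Perm ℕ), IsPartition ν ∧ IsFinitary u ∧ IsFinitary v ∧
    BruhatLE u v ∧ act u ν = γ ∧ act v ν = α

/-! ### Tableaux -/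

/-- The (Young diagram of the) partition `α⁺`: its row lengths are the positive parts of `α` in
weakly decreasing order. -/
noncomputable def sortedShape (α : Comp) : YoungDiagram :=
  YoungDiagram.ofRowLens ((α.support.val.map α).sort (· ≥ ·))
    (Multiset.pairwise_sort (α.support.val.map α) (· ≥ ·)).sortedGE

/-- Reverse semistandard Young tableaux of shape `μ`: entries decrease weakly along rows and
strictly down columns.  `entry i j` is the entry in row `i`, column `j`; it is `0`, without
meaning, outside `μ`. -/
@[ext]
structure RSSYT (μ : YoungDiagram) where
  entry : ℕ → ℕ → ℕ
  row_weak : ∀ i j, (i, j + 1) ∈ μ → entry i (j + 1) ≤ entry i j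
  col_strict : ∀ i j, (i + 1, j) ∈ μ → entry (i + 1) j < entry i j
  zeros : ∀ i j, (i, j) ∉ μ → entry i j = 0

/-- Reverse set-valued tableaux of shape `μ`: every box holds a finite nonempty set, and
`min T(s) ≥ max T(t)` (resp. `>`) if `t` is immediately right of (resp. below) `s`. -/
@[ext]
structure RSVT (μ : YoungDiagram) where
  entry : ℕ → ℕ → Finset ℕ
  nonempty : ∀ i j, (i, j) ∈ μ → (entry i j).Nonempty
  row_weak : ∀ i j, (i, j + 1) ∈ μ → ∀ x ∈ entry i j, ∀ y ∈ entry i (j + 1), y ≤ x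
  col_strict : ∀ i j, (i + 1, j) ∈ μ → ∀ x ∈ entry i j, ∀ y ∈ entry (i + 1) j, y < x
  empty : ∀ i j, (i, j) ∉ μ → entry i j = ∅

namespace RSVT

variable {μ : YoungDiagram}

/-- The weight of `T`: its `k`-th part is the number of times `k` appears in `T`. -/
noncomputable def wt (T : RSVT μ) : Comp :=
  ∑ c ∈ μ.cells, ∑ k ∈ T.entry c.1 c.2, Finsupp.single k 1

/-- The excess `ex(T) = |wt(T)| - |μ|`; the difference is never negative since all boxes of `T` are
nonempty. -/
noncomputable def ex (T : RSVT μ) : ℕ := T.wt.degree - μ.card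

theorem sup_mem (T : RSVT μ) {i j : ℕ} (h : (i, j) ∈ μ) : (T.entry i j).sup id ∈ T.entry i j := by
  obtain ⟨x, hx, e⟩ := Finset.exists_mem_eq_sup _ (T.nonempty i j h) id
  rw [e]
  exact hx

/-- The tableau `L(T)`, each set being replaced by its maximum. -/
def L (T : RSVT μ) : RSSYT μ where
  entry i j := (T.entry i j).sup id
  row_weak i j h := T.row_weak i j h _ (T.sup_mem (μ.up_left_mem le_rfl (Nat.le_succ j) h)) _
    (T.sup_mem h)
  col_strict i j h := T.col_strict i j h _ (T.sup_mem (μ.up_left_mem (Nat.le_succ i) le_rfl h)) _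
    (T.sup_mem h)
  zeros i j h := by simp [T.empty i j h]

end RSVT

/-! ### Left keys -/

/-- Greedy choice: for an increasing list `a₁ < a₂ < …`, pick the smallest `b₁ ∈ C` with `b₁ ≥ a₁`,
then the smallest `b₂ ∈ C` with `b₂ ≥ a₂` and `b₂ > b₁`, and so on.  (The process stops if there
is no such element, which never happens for columns of a reverse semistandard tableau.) -/
def greedy : Finset ℕ → List ℕ → Finset ℕ
  | _, [] => ∅
  | C, a :: l =>
    if h : (C.filter (a ≤ ·)).Nonempty then
      let b := (C.filter (a ≤ ·)).min' h
      insert b (greedy (C.filter (b < ·)) l)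
    else ∅

/-- The column `C₁ ◁ C₂`. -/
def tri (C₁ C₂ : Finset ℕ) : Finset ℕ := greedy C₁ (C₂.sort (· ≤ ·))

namespace RSSYT

variable {μ : YoungDiagram}

/-- The set of entries of column `j`. -/
def col (T : RSSYT μ) (j : ℕ) : Finset ℕ := (Finset.range (μ.colLen j)).image fun i => T.entry i j

/-- Column `k` of the left key tableau of `T`: `C₀ ◁ (C₁ ◁ (⋯ ◁ C_k))`, where `C_j` is column `j`
of `T`. -/
def leftKeyCol (T : RSSYT μ) (k : ℕ) : Finset ℕ :=
  ((List.range k).map T.col).foldr tri (T.col k)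

/-- The left key `K_-(T)` as a composition: its part `i` is the number of columns of the left key
tableau that contain `i`. -/
noncomputable def leftKey (T : RSSYT μ) : Comp :=
  ∑ k ∈ Finset.range (μ.rowLen 0), ∑ i ∈ T.leftKeyCol k, Finsupp.single i 1

end RSSYT

end Lascoux

namespace Lascoux
open MvPolynomial

/-! ### Bruhat order on compositions -/

/-! Let `S = L(T)`. A letter `k` can be added below the maximum in at most one box of column `j` of
`S`: this is possible iff `k` is not in column `j` and column `j` has more entries above `k` than
column `j + 1`. These choices are independent, so summing over all `T` with `L(T) = S` gives `x^S`
times one factor `1 + β x_k` for each such pair (`RSVT.sum_fiber`, `RSSYT.prod_boxWt`). It remains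
to sum this product over the reverse semistandard `S` with `K_-(S) ≤ α`, and to show that the result
has the initial values and the recursion of the Lascoux polynomials.

Build `S` by inserting the letters in decreasing order `n - 1, …, 0`, each into a set of columns.
The greedy choice `◁` is a parking process: `c` is occupied iff some interval `[a, c]` contains at
least as many cars as spots (`mem_tri`). From this criterion, inserting a new smallest letter
changes the nested key columns by a local rule: if column `j` receives the letter, its key column
`A` gains the least element of `B \ A`, where `B` is the new key column to the left; otherwise it is
unchanged (`keyCol_addRow_succ`). The factor attached to a letter and a column is also visible on
the key columns. So the weighted sum over all `S` of a function of the key is obtained by applying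
one transfer operator `row` per letter to a list of empty columns (`rows_eq_sum`).

The core is the study of the two operators for the letters `i + 1` and `i`. By induction on the
number of columns, three relations hold between their compositions for various left boundaries
(`twoRow_relations`). The third says that `π_i` replaces the intermediate boundary `B ∪ {i + 1}` by
`B ∪ {i}`, if the remaining function is symmetric in `x_i` and `x_{i+1}`. This is the effect of
`shift i`, which turns `i + 1` into `i` in every key column that contains `i + 1` but not `i`. The
operators for the letters above `i + 1` commute with `π_i`, those for the letters below `i` commute
with `shift i` and preserve the symmetry. Hence `π_i` of the sum of `wt(S) F(key S)` is the sum of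
`wt(S) F(shift_i key S)` (`piBeta_rows`).

On compositions `shift i` sorts the parts `i` and `i + 1` into decreasing order. For `F` the
indicator function of `K_- ≤ s_i α`, where `i` is an ascent of `α`, the lifting property of the
Bruhat order (`compLE_iff_sortDesc`) says that `F ∘ shift_i` is the indicator function of `K_- ≤ α`.
This is the required recursion. If `α` is a partition, only one `S` contributes, with weight `x^α`.
-/

theorem act_apply (w : Equiv.Perm ℕ) (α : Comp) (k : ℕ) : act w α k = α (w.symm k) := by
  simp [act, Finsupp.equivMapDomain_apply]

theorem act_mul (u v : Equiv.Perm ℕ) (α : Comp) : act (u * v) α = act u (act v α) := by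
  ext k
  simp only [act_apply]
  rfl

theorem act_swap_apply (p q : ℕ) (α : Comp) (k : ℕ) :
    act (Equiv.swap p q) α k = α (Equiv.swap p q k) := by
  rw [act_apply, Equiv.symm_swap]

theorem isFinitary_one : IsFinitary 1 := by simp [IsFinitary]

theorem isFinitary_swap (p q : ℕ) : IsFinitary (Equiv.swap p q) :=
  (Set.toFinite {p, q}).subset fun k hk => by
    by_contra hc
    simp only [Set.mem_insert_iff, Set.mem_singleton_iff, not_or] at hc
    exact hk (Equiv.swap_apply_of_ne_of_ne hc.1 hc.2)

theorem IsFinitary.mul {u v : Equiv.Perm ℕ} (hu : IsFinitary u) (hv : IsFinitary v) :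
    IsFinitary (u * v) :=
  (Set.Finite.union hu hv).subset fun k hk => by
    by_contra hc
    simp only [Set.mem_union, Set.mem_ofPred_eq, not_or, not_not] at hc
    exact hk (by rw [Equiv.Perm.mul_apply, hc.2, hc.1])

/-- `δ` arises from `γ` by moving a larger part to the right past a smaller one. -/
def SwapStep (γ δ : Comp) : Prop := ∃ p q, p < q ∧ γ q < γ p ∧ δ = act (Equiv.swap p q) γ

/-- The reflexive transitive closure of `SwapStep`. -/
def SwapLE : Comp → Comp → Prop := Relation.ReflTransGen SwapStep

theorem sComp_sComp (i : ℕ) (α : Comp) : sComp i (sComp i α) = α := by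
  ext k
  simp [sComp_apply]

theorem exists_isPartition_act (γ : Comp) :
    ∃ (ν : Comp) (u : Equiv.Perm ℕ), IsPartition ν ∧ IsFinitary u ∧ act u ν = γ := by
  induction h : moment γ using Nat.strong_induction_on generalizing γ with
  | _ m ih =>
    by_cases hp : ∃ i, γ i < γ (i + 1)
    · obtain ⟨i, hi⟩ := hp
      obtain ⟨ν, u, hν, hu, e⟩ := ih _ (h ▸ moment_sComp_lt hi) _ rfl
      refine ⟨ν, Equiv.swap i (i + 1) * u, hν, (isFinitary_swap _ _).mul hu, ?_⟩
      rw [act_mul, e]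
      exact sComp_sComp i γ
    · push Not at hp
      exact ⟨γ, 1, antitone_nat_of_succ_le hp, isFinitary_one, by ext k; rw [act_apply]; rfl⟩

theorem swapLE_act_swap {γ : Comp} {p q : ℕ} (h : p < q) (hv : γ q ≤ γ p) :
    SwapLE γ (act (Equiv.swap p q) γ) := by
  rcases hv.lt_or_eq with hv | hv
  · exact .single ⟨p, q, h, hv, rfl⟩
  · have : act (Equiv.swap p q) γ = γ := by
      ext k
      rw [act_swap_apply, Equiv.swap_apply_def]
      grind
    rw [this]
    exact .refl

/-- Bruhat steps on permutations act on the orbit of a partition by swap steps or trivially, and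
each swap step lifts to a Bruhat step. This makes the order accessible without representatives. -/
theorem compLE_iff_swapLE {γ α : Comp} : CompLE γ α ↔ SwapLE γ α := by
  constructor
  · rintro ⟨ν, u, v, hν, -, -, h, rfl, rfl⟩
    induction h with
    | refl => exact .refl
    | @tail v w _ h ih =>
      obtain ⟨a, b, hab, hv, rfl⟩ := h
      -- `v (a b) = (v a, v b) v`. As `ν` decreases, the part moved to the right is the larger one,
      -- or both parts agree.
      have e : act (v * Equiv.swap a b) ν = act (Equiv.swap (v a) (v b)) (act v ν) := by
        rw [← act_mul]
        congr 1
        ext k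
        simp only [Equiv.Perm.mul_apply, Equiv.swap_apply_def, EmbeddingLike.apply_eq_iff_eq]
        grind
      rw [e]
      refine ih.trans (swapLE_act_swap hv ?_)
      simpa [act_apply] using hν hab.le
  · intro h
    obtain ⟨ν, u, hν, hu, rfl⟩ := exists_isPartition_act γ
    suffices ∃ v, IsFinitary v ∧ BruhatLE u v ∧ act v ν = α by
      obtain ⟨v, hv, h1, h2⟩ := this
      exact ⟨ν, u, v, hν, hu, hv, h1, rfl, h2⟩
    induction h with
    | refl => exact ⟨u, hu, .refl, rfl⟩
    | tail _ h ih =>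
      obtain ⟨v, hv, h1, rfl⟩ := ih
      obtain ⟨p, q, hpq, hlt, rfl⟩ := h
      rw [act_apply, act_apply] at hlt
      refine ⟨v * Equiv.swap (v.symm p) (v.symm q), hv.mul (isFinitary_swap _ _),
        h1.tail ⟨v.symm p, v.symm q, ?_, by simpa using hpq, rfl⟩, ?_⟩
      -- The larger part, now at `p`, sits at an earlier position of the partition `ν` than the
      -- smaller one.
      · by_contra hc
        exact absurd (hν (not_lt.mp hc)) (not_le.mpr hlt)
      · rw [← act_mul]
        congr 1
        ext k
        simp [Equiv.swap_apply_def, Equiv.eq_symm_apply]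
        grind

/-! ### Sorting adjacent parts and the lifting property -/

/-- Sort the parts `i` and `i + 1` into weakly decreasing order. -/
noncomputable def sortDesc (i : ℕ) (γ : Comp) : Comp := if γ i < γ (i + 1) then sComp i γ else γ

/-- Sort the parts `i` and `i + 1` into weakly increasing order. -/
noncomputable def sortAsc (i : ℕ) (γ : Comp) : Comp := if γ (i + 1) < γ i then sComp i γ else γ

theorem sortDesc_apply (i : ℕ) (γ : Comp) (k : ℕ) : sortDesc i γ k =
    if k = i then max (γ i) (γ (i + 1)) else if k = i + 1 then min (γ i) (γ (i + 1)) else γ k := by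
  unfold sortDesc
  split_ifs <;> simp_all [sComp_apply, Equiv.swap_apply_def] <;> omega

theorem sortAsc_apply (i : ℕ) (γ : Comp) (k : ℕ) : sortAsc i γ k =
    if k = i then min (γ i) (γ (i + 1)) else if k = i + 1 then max (γ i) (γ (i + 1)) else γ k := by
  unfold sortAsc
  split_ifs <;> simp_all [sComp_apply, Equiv.swap_apply_def] <;> omega

theorem swapLE_of_eq {γ δ : Comp} (p q : ℕ) (h : p < q) (hv : γ q ≤ γ p)
    (e : ∀ k, δ k = γ (Equiv.swap p q k)) : SwapLE γ δ := by
  have : δ = act (Equiv.swap p q) γ := by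
    ext k
    rw [act_swap_apply, e]
  rw [this]
  exact swapLE_act_swap h hv

theorem swapLE_of_eq₂ {γ δ : Comp} (p q p' q' : ℕ) (h : p < q) (hv : γ q ≤ γ p) (h' : p' < q')
    (hv' : γ (Equiv.swap p q q') ≤ γ (Equiv.swap p q p'))
    (e : ∀ k, δ k = γ (Equiv.swap p q (Equiv.swap p' q' k))) : SwapLE γ δ :=
  (swapLE_act_swap h hv).trans <| swapLE_of_eq p' q' h' (by simpa [act_swap_apply] using hv')
    fun k => by rw [e, act_swap_apply]

/-- Only a swap that meets `{i, i + 1}` in one position needs care. The outcome then depends on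
where the other part in `{i, i + 1}` lies relative to the two swapped parts; if it lies strictly
between them, two swaps are needed. -/
theorem SwapStep.sortDesc {γ δ : Comp} (i : ℕ) (h : SwapStep γ δ) :
    SwapLE (sortDesc i γ) (sortDesc i δ) := by
  obtain ⟨p, q, hpq, hlt, rfl⟩ := h
  by_cases h1 : p = i ∧ q = i + 1
  · have : Lascoux.sortDesc i (act (Equiv.swap p q) γ) = Lascoux.sortDesc i γ := by
      ext k
      simp only [sortDesc_apply, act_swap_apply, Equiv.swap_apply_def]
      grind
    rw [this]
    exact .refl
  by_cases h2 : (p = i ∨ p = i + 1) ∨ (q = i ∨ q = i + 1)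
  swap
  · exact swapLE_of_eq p q (by omega) (by simp only [sortDesc_apply]; grind) fun k => by
        simp only [sortDesc_apply, act_swap_apply, Equiv.swap_apply_def]; grind
  rcases h2 with hp | hq
  -- `o` is the position in `{i, i + 1}` that the swap does not move.
  · obtain ⟨o, ho⟩ : ∃ o, (o = i ∨ o = i + 1) ∧ o ≠ p :=
      ⟨2 * i + 1 - p, by omega⟩
    rcases le_or_gt (γ p) (γ o) with hB | hB
    · exact swapLE_of_eq (i+1) q (by omega) (by simp only [sortDesc_apply]; grind) fun k => by
        simp only [sortDesc_apply, act_swap_apply, Equiv.swap_apply_def]; grind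
    rcases le_or_gt (γ o) (γ q) with hC | hC
    · exact swapLE_of_eq i q (by omega) (by simp only [sortDesc_apply]; grind) fun k => by
        simp only [sortDesc_apply, act_swap_apply, Equiv.swap_apply_def]; grind
    · exact swapLE_of_eq₂ (i+1) q i q (by omega) (by simp only [sortDesc_apply]; grind) (by omega) (by simp only [sortDesc_apply, Equiv.swap_apply_def]; grind) fun k => by
        simp only [sortDesc_apply, act_swap_apply, Equiv.swap_apply_def]; grind
  · obtain ⟨o, ho⟩ : ∃ o, (o = i ∨ o = i + 1) ∧ o ≠ q :=
      ⟨2 * i + 1 - q, by omega⟩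
    rcases le_or_gt (γ p) (γ o) with hB | hB
    · exact swapLE_of_eq p (i+1) (by omega) (by simp only [sortDesc_apply]; grind) fun k => by
        simp only [sortDesc_apply, act_swap_apply, Equiv.swap_apply_def]; grind
    rcases le_or_gt (γ o) (γ q) with hC | hC
    · exact swapLE_of_eq p i (by omega) (by simp only [sortDesc_apply]; grind) fun k => by
        simp only [sortDesc_apply, act_swap_apply, Equiv.swap_apply_def]; grind
    · exact swapLE_of_eq₂ p i p (i+1) (by omega) (by simp only [sortDesc_apply]; grind) (by omega) (by simp only [sortDesc_apply, Equiv.swap_apply_def]; grind) fun k => by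
        simp only [sortDesc_apply, act_swap_apply, Equiv.swap_apply_def]; grind

theorem SwapStep.sortAsc {γ δ : Comp} (i : ℕ) (h : SwapStep γ δ) :
    SwapLE (sortAsc i γ) (sortAsc i δ) := by
  obtain ⟨p, q, hpq, hlt, rfl⟩ := h
  by_cases h1 : p = i ∧ q = i + 1
  · have : Lascoux.sortAsc i (act (Equiv.swap p q) γ) = Lascoux.sortAsc i γ := by
      ext k
      simp only [sortAsc_apply, act_swap_apply, Equiv.swap_apply_def]
      grind
    rw [this]
    exact .refl
  by_cases h2 : (p = i ∨ p = i + 1) ∨ (q = i ∨ q = i + 1)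
  swap
  · exact swapLE_of_eq p q (by omega) (by simp only [sortAsc_apply]; grind) fun k => by
        simp only [sortAsc_apply, act_swap_apply, Equiv.swap_apply_def]; grind
  rcases h2 with hp | hq
  · obtain ⟨o, ho⟩ : ∃ o, (o = i ∨ o = i + 1) ∧ o ≠ p :=
      ⟨2 * i + 1 - p, by omega⟩
    rcases le_or_gt (γ p) (γ o) with hB | hB
    · exact swapLE_of_eq i q (by omega) (by simp only [sortAsc_apply]; grind) fun k => by
        simp only [sortAsc_apply, act_swap_apply, Equiv.swap_apply_def]; grind
    rcases le_or_gt (γ o) (γ q) with hC | hC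
    · exact swapLE_of_eq (i+1) q (by omega) (by simp only [sortAsc_apply]; grind) fun k => by
        simp only [sortAsc_apply, act_swap_apply, Equiv.swap_apply_def]; grind
    · exact swapLE_of_eq₂ (i+1) q i (i+1) (by omega) (by simp only [sortAsc_apply]; grind) (by omega) (by simp only [sortAsc_apply, Equiv.swap_apply_def]; grind) fun k => by
        simp only [sortAsc_apply, act_swap_apply, Equiv.swap_apply_def]; grind
  · obtain ⟨o, ho⟩ : ∃ o, (o = i ∨ o = i + 1) ∧ o ≠ q :=
      ⟨2 * i + 1 - q, by omega⟩
    rcases le_or_gt (γ p) (γ o) with hB | hB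
    · exact swapLE_of_eq p i (by omega) (by simp only [sortAsc_apply]; grind) fun k => by
        simp only [sortAsc_apply, act_swap_apply, Equiv.swap_apply_def]; grind
    rcases le_or_gt (γ o) (γ q) with hC | hC
    · exact swapLE_of_eq p (i+1) (by omega) (by simp only [sortAsc_apply]; grind) fun k => by
        simp only [sortAsc_apply, act_swap_apply, Equiv.swap_apply_def]; grind
    · exact swapLE_of_eq₂ p i i (i+1) (by omega) (by simp only [sortAsc_apply]; grind) (by omega) (by simp only [sortAsc_apply, Equiv.swap_apply_def]; grind) fun k => by
        simp only [sortAsc_apply, act_swap_apply, Equiv.swap_apply_def]; grind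

theorem SwapLE.sortDesc {γ δ : Comp} (i : ℕ) (h : SwapLE γ δ) :
    SwapLE (sortDesc i γ) (sortDesc i δ) := by
  induction h with
  | refl => exact .refl
  | tail _ h ih => exact ih.trans (h.sortDesc i)

theorem SwapLE.sortAsc {γ δ : Comp} (i : ℕ) (h : SwapLE γ δ) :
    SwapLE (sortAsc i γ) (sortAsc i δ) := by
  induction h with
  | refl => exact .refl
  | tail _ h ih => exact ih.trans (h.sortAsc i)

theorem swapLE_sortAsc (i : ℕ) (γ : Comp) : SwapLE γ (sortAsc i γ) := by
  unfold Lascoux.sortAsc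
  split_ifs with h
  · exact swapLE_act_swap (Nat.lt_succ_self i) h.le
  · exact .refl

/-- The lifting property of the Bruhat order, for compositions. -/
theorem compLE_iff_sortDesc {i : ℕ} {α : Comp} (h : α i < α (i + 1)) (γ : Comp) :
    CompLE γ α ↔ CompLE (sortDesc i γ) (sComp i α) := by
  rw [compLE_iff_swapLE, compLE_iff_swapLE]
  have e1 : sortDesc i α = sComp i α := if_pos h
  have e2 : sortAsc i (sComp i α) = α := by
    rw [sortAsc, if_pos (by simpa [sComp_left, sComp_right] using h), sComp_sComp]
  refine ⟨fun hγ => e1 ▸ hγ.sortDesc i, fun hγ => ?_⟩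
  -- The chain is `γ ≤ sortAsc γ = sortAsc (sortDesc γ) ≤ sortAsc (s_i α) = α`.
  have h3 : sortAsc i (sortDesc i γ) = sortAsc i γ := by
    ext k
    simp only [sortAsc_apply, sortDesc_apply]
    grind
  have := hγ.sortAsc i
  rw [e2, h3] at this
  exact (swapLE_sortAsc i γ).trans this

theorem compLE_isPartition {α γ : Comp} (h : IsPartition α) : CompLE γ α ↔ γ = α := by
  rw [compLE_iff_swapLE]
  refine ⟨fun hγ => ?_, fun hγ => hγ ▸ .refl⟩
  rcases Relation.ReflTransGen.cases_tail hγ with e | ⟨δ, -, p, q, hpq, hlt, e⟩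
  · exact e.symm
  · have := h hpq.le
    rw [e, act_swap_apply, act_swap_apply, Equiv.swap_apply_left, Equiv.swap_apply_right] at this
    omega

/-! ### Support and multiset of parts along the order -/

theorem SwapLE.zero_of_ge {γ α : Comp} (h : SwapLE γ α) {n : ℕ} (hα : ∀ k, n ≤ k → α k = 0) :
    ∀ k, n ≤ k → γ k = 0 := by
  induction h using Relation.ReflTransGen.head_induction_on with
  | refl => exact hα
  | @head γ δ h _ ih =>
    obtain ⟨p, q, hpq, hlt, rfl⟩ := h
    simp only [act_swap_apply, Equiv.swap_apply_def] at ih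
    intro k hk
    have hq : q < n := by
      by_contra hc
      have := ih q (by omega)
      grind
    have := ih k hk
    grind

theorem SwapLE.card_eq {γ α : Comp} (h : SwapLE γ α) {n : ℕ} (hα : ∀ k, n ≤ k → α k = 0)
    (t : ℕ) : ((Finset.range n).filter (t < γ ·)).card = ((Finset.range n).filter (t < α ·)).card := by
  induction h with
  | refl => rfl
  | @tail δ ε h0 h ih =>
    have hδ : ∀ k, n ≤ k → δ k = 0 := SwapLE.zero_of_ge (.single h) hα
    rw [ih hδ]
    obtain ⟨p, q, hpq, hlt, rfl⟩ := h
    have hs : ∀ k, Equiv.swap p q (Equiv.swap p q k) = k := fun k => Equiv.swap_apply_self ..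
    refine Finset.card_nbij' (Equiv.swap p q) (Equiv.swap p q) ?_ ?_ (fun k _ => hs k)
      (fun k _ => hs k)
    all_goals
      intro k hk
      simp only [Finset.coe_filter, Finset.mem_range, Set.mem_ofPred_eq, act_swap_apply, hs] at hk ⊢
      refine ⟨?_, hk.2⟩
      by_contra hc
    · have := hα _ (not_lt.mp hc)
      rw [act_swap_apply, hs] at this
      omega
    · have := hδ _ (not_lt.mp hc)
      omega


/-! ### The operation `◁` as a parking process -/

/-- The number of elements of `S` between `a` and `c`. -/
def countIcc (S : Finset ℕ) (a c : ℕ) : ℕ := (S ∩ Finset.Icc a c).card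

/-- The number of elements of `S` that are at least `a`. -/
def countGe (S : Finset ℕ) (a : ℕ) : ℕ := (S.filter (a ≤ ·)).card

theorem countIcc_insert {S : Finset ℕ} {x : ℕ} (hx : x ∉ S) (a c : ℕ) :
    countIcc (insert x S) a c = countIcc S a c + if a ≤ x ∧ x ≤ c then 1 else 0 := by
  unfold countIcc
  split_ifs with h
  · rw [Finset.insert_inter_of_mem (by simpa using h),
      Finset.card_insert_of_notMem (by simp [hx])]
  · rw [Finset.insert_inter_of_notMem (by simpa using h), add_zero]

theorem countGe_insert {S : Finset ℕ} {x : ℕ} (hx : x ∉ S) (a : ℕ) :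
    countGe (insert x S) a = countGe S a + if a ≤ x then 1 else 0 := by
  unfold countGe
  rw [Finset.filter_insert]
  split_ifs with h
  · rw [Finset.card_insert_of_notMem (by simp [hx])]
  · simp

theorem countIcc_mono {S T : Finset ℕ} (h : S ⊆ T) (a c : ℕ) : countIcc S a c ≤ countIcc T a c :=
  Finset.card_le_card (Finset.inter_subset_inter_right h)

theorem countGe_mono {S T : Finset ℕ} (h : S ⊆ T) (a : ℕ) : countGe S a ≤ countGe T a :=
  Finset.card_le_card (Finset.filter_subset_filter _ h)

theorem countIcc_congr {S T : Finset ℕ} {a c : ℕ} (h : ∀ x, a ≤ x → x ≤ c → (x ∈ S ↔ x ∈ T)) :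
    countIcc S a c = countIcc T a c := by
  unfold countIcc
  congr 1
  ext x
  simp only [Finset.mem_inter, Finset.mem_Icc]
  grind

theorem countIcc_pos {S : Finset ℕ} {a c x : ℕ} (hx : x ∈ S) (h : a ≤ x) (h' : x ≤ c) :
    0 < countIcc S a c :=
  Finset.card_pos.mpr ⟨x, by simp [hx, h, h']⟩

theorem countIcc_add (S : Finset ℕ) {a b c : ℕ} (h : a ≤ b + 1) (h' : b ≤ c) :
    countIcc S a c = countIcc S a b + countIcc S (b + 1) c := by
  unfold countIcc
  rw [← Finset.card_union_of_disjoint]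
  · congr 1
    ext x
    simp only [Finset.mem_inter, Finset.mem_union, Finset.mem_Icc]
    grind
  · rw [Finset.disjoint_left]
    intro x
    simp only [Finset.mem_inter, Finset.mem_Icc]
    grind

theorem countGe_zero (S : Finset ℕ) : countGe S 0 = S.card := by simp [countGe]

theorem greedy_cons (C : Finset ℕ) (a b : ℕ) (l : List ℕ) (hb : b ∈ C) (hab : a ≤ b)
    (hm : ∀ c ∈ C, a ≤ c → b ≤ c) :
    greedy C (a :: l) = insert b (greedy (C.filter (b < ·)) l) := by
  have h : (C.filter (a ≤ ·)).Nonempty := ⟨b, by simp [hb, hab]⟩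
  have e : (C.filter (a ≤ ·)).min' h = b := by
    refine le_antisymm (Finset.min'_le _ _ (by simp [hb, hab])) ?_
    have := Finset.min'_mem _ h
    simp only [Finset.mem_filter] at this
    exact hm _ this.1 this.2
  simp only [greedy, dif_pos h, e]

theorem greedy_cons_of_lt (C : Finset ℕ) (a : ℕ) (l : List ℕ) (hm : ∀ c ∈ C, c < a) :
    greedy C (a :: l) = ∅ := by
  have h : ¬ (C.filter (a ≤ ·)).Nonempty := by
    rintro ⟨x, hx⟩
    simp only [Finset.mem_filter] at hx
    exact absurd (hm x hx.1) (by omega)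
  simp only [greedy, dif_neg h]

theorem greedy_cases (C : Finset ℕ) (a : ℕ) :
    (∀ c ∈ C, c < a) ∨ ∃ b ∈ C, a ≤ b ∧ ∀ c ∈ C, a ≤ c → b ≤ c := by
  by_cases h : (C.filter (a ≤ ·)).Nonempty
  · right
    have := Finset.min'_mem _ h
    simp only [Finset.mem_filter] at this
    exact ⟨_, this.1, this.2, fun c hc hac => Finset.min'_le _ _ (by simp [hc, hac])⟩
  · left
    intro c hc
    by_contra hcc
    exact h ⟨c, by simp [hc]; omega⟩

theorem greedy_subset (C : Finset ℕ) (l : List ℕ) : greedy C l ⊆ C := by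
  induction l generalizing C with
  | nil => simp [greedy]
  | cons a l ih =>
    rcases greedy_cases C a with h | ⟨b, hb, hab, hm⟩
    · simp [greedy_cons_of_lt C a l h]
    · rw [greedy_cons C a b l hb hab hm]
      exact Finset.insert_subset hb ((ih _).trans (Finset.filter_subset _ _))

/-- With the letters of `l` as cars and those of `C` as spots, a spot is occupied iff the cars
starting in some interval that ends there suffice to fill it. This criterion does not mention the
order of the choices, and monotonicity in the set of cars is evident from it. -/
theorem mem_greedy (C : Finset ℕ) (l : List ℕ) (hl : l.SortedLT) (c : ℕ) :
    c ∈ greedy C l ↔ c ∈ C ∧ ∃ a ≤ c, countIcc C a c ≤ countIcc l.toFinset a c := by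
  induction l generalizing C with
  | nil =>
    simp only [greedy, Finset.notMem_empty, false_iff, not_and, not_exists, not_le]
    intro hc a ha
    have := countIcc_pos hc ha le_rfl
    simpa [countIcc] using this
  | cons a₀ l ih =>
    have hl' : l.SortedLT := by
      rw [List.sortedLT_iff_pairwise] at hl ⊢
      exact hl.of_cons
    have hlt : ∀ x ∈ l, a₀ < x := by
      rw [List.sortedLT_iff_pairwise] at hl
      exact (List.pairwise_cons.mp hl).1
    have hn : a₀ ∉ l.toFinset := fun h => lt_irrefl _ (hlt _ (by simpa using h))
    have key : ∀ a c, c < a₀ → countIcc (a₀ :: l).toFinset a c = 0 := by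
      intro a c h
      rw [countIcc, Finset.card_eq_zero, Finset.eq_empty_iff_forall_notMem]
      intro x hx
      simp only [List.toFinset_cons, Finset.mem_inter, Finset.mem_insert, List.mem_toFinset,
        Finset.mem_Icc] at hx
      rcases hx.1 with h1 | h1
      · omega
      · have := hlt x h1
        omega
    by_cases hc0 : c ∈ C ∧ c < a₀
    · have : ¬ ∃ a ≤ c, countIcc C a c ≤ countIcc (a₀ :: l).toFinset a c := by
        rintro ⟨a, ha, h⟩
        rw [key a c hc0.2] at h
        have := countIcc_pos hc0.1 ha le_rfl
        omega
      simp only [this, and_false, iff_false]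
      rcases greedy_cases C a₀ with h | ⟨b, hb, hab, hm⟩
      · simp [greedy_cons_of_lt C a₀ l h]
      · rw [greedy_cons C a₀ b l hb hab hm, Finset.mem_insert]
        rintro (rfl | h)
        · omega
        · have := greedy_subset _ _ h
          simp only [Finset.mem_filter] at this
          omega
    rcases greedy_cases C a₀ with h | ⟨b, hb, hab, hm⟩
    · rw [greedy_cons_of_lt C a₀ l h]
      simp only [Finset.notMem_empty, false_iff, not_and]
      exact fun hc => absurd ⟨hc, h c hc⟩ hc0
    · rw [greedy_cons C a₀ b l hb hab hm, Finset.mem_insert, ih _ hl', Finset.mem_filter,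
        List.toFinset_cons]
      rcases lt_trichotomy c b with hcb | rfl | hcb
      · have : c ∉ C := fun hc => by
          have := hm c hc
          by_cases h : a₀ ≤ c
          · have := this h
            omega
          · exact hc0 ⟨hc, by omega⟩
        simp [this]
        omega
      · simp only [true_or, true_iff]
        refine ⟨hb, a₀, hab, ?_⟩
        have h1 : countIcc C a₀ c = 1 := by
          rw [countIcc, Finset.card_eq_one]
          refine ⟨c, ?_⟩
          ext x
          simp only [Finset.mem_inter, Finset.mem_Icc, Finset.mem_singleton]
          refine ⟨fun h => le_antisymm h.2.2 (hm x h.1 h.2.1), ?_⟩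
          rintro rfl
          exact ⟨hb, hab, le_rfl⟩
        rw [h1]
        exact countIcc_pos (x := a₀) (by simp) le_rfl hab
      · have hne : c ≠ b := hcb.ne'
        simp only [hne, false_or, hcb, and_true]
        refine and_congr_right fun hc => ?_
        have hCF : C.filter (b < ·) ⊆ C := Finset.filter_subset _ _
        constructor
        · rintro ⟨a, ha, h⟩
          rcases lt_or_ge b a with hba | hba
          · refine ⟨a, ha, ?_⟩
            rw [← countIcc_congr (S := C.filter (b < ·)) (T := C)]
            · exact h.trans (countIcc_mono (Finset.subset_insert _ _) _ _)
            · intro x h1 _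
              simp only [Finset.mem_filter]
              grind
          -- Enlarging the interval to start at `a₀` adds exactly one spot, `b`, and at least one
          -- car, `a₀`.
          · refine ⟨a₀, by omega, ?_⟩
            have e1 : countIcc C a₀ c = countIcc (insert b (C.filter (b < ·))) a₀ c := by
              refine countIcc_congr fun x h1 h2 => ?_
              simp only [Finset.mem_insert, Finset.mem_filter]
              constructor
              · intro hx
                have := hm x hx h1
                grind
              · rintro (rfl | hx)
                · exact hb
                · exact hx.1
            have e2 : countIcc (C.filter (b < ·)) a₀ c = countIcc (C.filter (b < ·)) a c := by
              unfold countIcc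
              congr 1
              ext x
              simp only [Finset.mem_inter, Finset.mem_filter, Finset.mem_Icc]
              grind
            have e3 : countIcc l.toFinset a c ≤ countIcc l.toFinset a₀ c := by
              refine Finset.card_le_card fun x => ?_
              simp only [Finset.mem_inter, List.mem_toFinset, Finset.mem_Icc]
              intro hx
              have := hlt x hx.1
              grind
            rw [e1, countIcc_insert (by simp), countIcc_insert hn, e2, if_pos (by omega),
              if_pos (by omega)]
            omega
        · rintro ⟨a, ha, h⟩
          refine ⟨a, ha, ?_⟩
          rw [countIcc_insert hn] at h
          by_cases h0 : a ≤ a₀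
          · rw [if_pos (by omega)] at h
            have : countIcc (insert b (C.filter (b < ·))) a c ≤ countIcc C a c :=
              countIcc_mono (Finset.insert_subset hb hCF) _ _
            rw [countIcc_insert (by simp), if_pos (by omega)] at this
            omega
          · rw [if_neg (by omega)] at h
            exact (countIcc_mono hCF _ _).trans (by simpa using h)

theorem mem_tri {C S : Finset ℕ} {c : ℕ} :
    c ∈ tri C S ↔ c ∈ C ∧ ∃ a ≤ c, countIcc C a c ≤ countIcc S a c := by
  rw [tri, mem_greedy _ _ (Finset.sortedLT_sort S), Finset.sort_toFinset]

theorem tri_subset (C S : Finset ℕ) : tri C S ⊆ C := greedy_subset _ _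

theorem tri_mono (C : Finset ℕ) {S T : Finset ℕ} (h : S ⊆ T) : tri C S ⊆ tri C T := by
  intro c
  rw [mem_tri, mem_tri]
  rintro ⟨hc, a, ha, h'⟩
  exact ⟨hc, a, ha, h'.trans (countIcc_mono h _ _)⟩

/-- Dominance of `C` over the list guarantees that the greedy choice never fails; it passes to the
remaining letters and the spots above the first choice. -/
theorem greedy_count (C : Finset ℕ) (l : List ℕ) (hl : l.SortedLT)
    (h : ∀ a, countGe l.toFinset a ≤ countGe C a) :
    (greedy C l).card = l.length ∧ ∀ a, countGe l.toFinset a ≤ countGe (greedy C l) a := by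
  induction l generalizing C with
  | nil => simp [greedy, countGe]
  | cons a₀ l ih =>
    have hl' : l.SortedLT := by
      rw [List.sortedLT_iff_pairwise] at hl ⊢
      exact hl.of_cons
    have hlt : ∀ x ∈ l, a₀ < x := by
      rw [List.sortedLT_iff_pairwise] at hl
      exact (List.pairwise_cons.mp hl).1
    have hn : a₀ ∉ l.toFinset := fun h => lt_irrefl _ (hlt _ (by simpa using h))
    rw [List.toFinset_cons] at h ⊢
    have h0 := h a₀
    rw [countGe_insert hn, if_pos le_rfl] at h0
    rcases greedy_cases C a₀ with h1 | ⟨b, hb, hab, hm⟩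
    · have : countGe C a₀ = 0 := by
        rw [countGe, Finset.card_eq_zero, Finset.filter_eq_empty_iff]
        intro x hx
        exact not_le.mpr (h1 x hx)
      omega
    · have hbF : b ∉ C.filter (b < ·) := by simp
      have e1 : countGe C a₀ = countGe (insert b (C.filter (b < ·))) a₀ := by
        unfold countGe
        congr 1
        ext x
        simp only [Finset.mem_insert, Finset.mem_filter]
        constructor
        · intro hx
          have := hm x hx.1 hx.2
          grind
        · rintro ⟨rfl | hx, h⟩
          · exact ⟨hb, h⟩
          · exact ⟨hx.1, h⟩
      rw [e1, countGe_insert hbF, if_pos hab] at h0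
      have e2 : ∀ a ≤ b, countGe (C.filter (b < ·)) a = (C.filter (b < ·)).card := by
        intro a ha
        unfold countGe
        congr 1
        ext x
        simp only [Finset.mem_filter]
        grind
      have e3 : countGe l.toFinset a₀ = l.toFinset.card := by
        unfold countGe
        congr 1
        ext x
        simp only [Finset.mem_filter, List.mem_toFinset, and_iff_left_iff_imp]
        exact fun hx => (hlt x hx).le
      have hle : ∀ a, countGe l.toFinset a ≤ l.toFinset.card := fun a =>
        Finset.card_le_card (Finset.filter_subset _ _)
      obtain ⟨ih1, ih2⟩ := ih (C.filter (b < ·)) hl' (by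
        intro a
        rcases le_or_gt a b with ha | ha
        · have := hle a
          rw [e2 a ha]
          rw [e2 a₀ hab] at h0
          omega
        · have h2 := h a
          rw [countGe_insert hn, if_neg (by omega)] at h2
          refine h2.trans (Finset.card_le_card fun x => ?_)
          simp only [Finset.mem_filter]
          grind)
      have hbG : b ∉ greedy (C.filter (b < ·)) l := fun h => hbF (greedy_subset _ _ h)
      rw [greedy_cons C a₀ b l hb hab hm, Finset.card_insert_of_notMem hbG, ih1]
      refine ⟨rfl, fun a => ?_⟩
      rw [countGe_insert hn, countGe_insert hbG]
      have := ih2 a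
      split_ifs <;> omega

theorem card_tri {C S : Finset ℕ} (h : ∀ a, countGe S a ≤ countGe C a) :
    (tri C S).card = S.card := by
  rw [tri, (greedy_count C _ (Finset.sortedLT_sort S) (by simpa using h)).1, Finset.length_sort]

theorem countGe_le_tri {C S : Finset ℕ} (h : ∀ a, countGe S a ≤ countGe C a) (a : ℕ) :
    countGe S a ≤ countGe (tri C S) a := by
  have := (greedy_count C _ (Finset.sortedLT_sort S) (by simpa using h)).2 a
  simpa [tri] using this

/-! ### Parking one more car -/

/-- Add the smallest element of `B \ A` to `A` (if there is one). -/
def addMin (A B : Finset ℕ) : Finset ℕ :=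
  if h : (B \ A).Nonempty then insert ((B \ A).min' h) A else A

theorem addMin_eq {A B : Finset ℕ} {m : ℕ} (hB : m ∈ B) (hA : m ∉ A)
    (h : ∀ x ∈ B, x ∉ A → m ≤ x) : addMin A B = insert m A := by
  have hm : m ∈ B \ A := by simp [hA, hB]
  have hn : (B \ A).Nonempty := ⟨m, hm⟩
  rw [addMin, dif_pos hn]
  congr 1
  refine le_antisymm (Finset.min'_le _ _ hm) (Finset.le_min' _ _ _ fun x hx => ?_)
  simp only [Finset.mem_sdiff] at hx
  exact h x hx.1 hx.2

theorem addMin_of_subset {A B : Finset ℕ} (h : B ⊆ A) : addMin A B = A := by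
  rw [addMin, dif_neg]
  simpa [Finset.sdiff_nonempty] using h

theorem exists_addMin {A B : Finset ℕ} (h : ¬ B ⊆ A) :
    ∃ m ∈ B, m ∉ A ∧ (∀ x ∈ B, x ∉ A → m ≤ x) ∧ addMin A B = insert m A := by
  have hn : (B \ A).Nonempty := by simpa [Finset.sdiff_nonempty] using h
  have := Finset.min'_mem _ hn
  simp only [Finset.mem_sdiff] at this
  have h3 : ∀ x ∈ B, x ∉ A → (B \ A).min' hn ≤ x := fun x h1 h2 =>
    Finset.min'_le _ _ (by simp [h1, h2])
  exact ⟨_, this.1, this.2, h3, addMin_eq this.1 this.2 h3⟩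

/-- The operation `◁` commutes with `addMin`. -/
theorem tri_addMin {C S T : Finset ℕ} (hST : S ⊆ T)
    (h1 : (tri C (addMin S T)).card = (tri C S).card + 1) :
    tri C (addMin S T) = addMin (tri C S) (tri C T) := by
  by_cases hTS : T ⊆ S
  · rw [addMin_of_subset hTS] at h1
    omega
  obtain ⟨t, htT, htS, htm, e⟩ := exists_addMin hTS
  rw [e] at h1 ⊢
  have hsub : tri C S ⊆ tri C (insert t S) := tri_mono C (Finset.subset_insert _ _)
  have hsubT : tri C (insert t S) ⊆ tri C T := tri_mono C (Finset.insert_subset htT hST)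
  obtain ⟨p, hp, e2⟩ : ∃ p, p ∉ tri C S ∧ insert p (tri C S) = tri C (insert t S) := by
    have := (Finset.exists_eq_insert_iff (s := tri C S) (t := tri C (insert t S))).mpr
      ⟨hsub, h1.symm⟩
    obtain ⟨p, hp, e⟩ := this
    exact ⟨p, hp, e⟩
  rw [← e2] at hsubT
  rw [← e2, addMin_eq (hsubT (Finset.mem_insert_self _ _)) hp]
  -- Let `p` be the spot gained from the car `t`, with witness `[a, p]`. A spot `r < p` occupied for
  -- `T` but not for `S` would force `a ≤ t ≤ r`. On both `[a, r]` and `[r + 1, p]` there are then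
  -- fewer cars than spots, against the choice of `a`.
  intro r hrT hrS
  by_contra hlt
  push Not at hlt
  have hr1 : r ∉ tri C (insert t S) := by
    rw [← e2, Finset.mem_insert]
    rintro (rfl | h)
    · omega
    · exact hrS h
  have hp1 : p ∈ tri C (insert t S) := e2 ▸ Finset.mem_insert_self _ _
  rw [mem_tri] at hr1 hp1 hp hrT
  obtain ⟨hpC, a, hap, ha⟩ := hp1
  obtain ⟨hrC, a', har, ha'⟩ := hrT
  have hp' : ∀ b ≤ p, countIcc S b p < countIcc C b p := by
    intro b hb
    by_contra hc
    exact hp ⟨hpC, b, hb, not_lt.mp hc⟩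
  have hr' : ∀ b ≤ r, countIcc (insert t S) b r < countIcc C b r := by
    intro b hb
    by_contra hc
    exact hr1 ⟨hrC, b, hb, not_lt.mp hc⟩
  have htr : t ≤ r := by
    by_contra hc
    have : countIcc T a' r = countIcc (insert t S) a' r := by
      refine countIcc_congr fun x _ hx => ?_
      rw [Finset.mem_insert]
      constructor
      · intro hxT
        by_contra hh
        have := htm x hxT (by tauto)
        omega
      · rintro (rfl | h)
        · exact htT
        · exact hST h
    have := hr' a' har
    omega
  have htap : a ≤ t := by
    by_contra hc
    have := hp' a hap
    rw [countIcc_insert htS, if_neg (by omega)] at ha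
    omega
  have har' : a ≤ r := htap.trans htr
  have s1 := countIcc_add (insert t S) (a := a) (b := r) (c := p) (by omega) hlt.le
  have s2 := countIcc_add C (a := a) (b := r) (c := p) (by omega) hlt.le
  have s3 := hr' a har'
  have s4 := hp' (r + 1) hlt
  have s5 : countIcc (insert t S) (r + 1) p = countIcc S (r + 1) p := by
    rw [countIcc_insert htS, if_neg (by omega), add_zero]
  omega

/-- Cars at all spots of `C` would occupy the whole of `C`. Since `k` is the least of the cars
missing from `S`, `tri_addMin` applies with `T = {k} ∪ S ∪ C`. -/
theorem tri_insert_right {C S : Finset ℕ} {k : ℕ} (hk : ∀ x ∈ S, k < x) (hC : ∀ x ∈ C, k ≤ x)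
    (h1 : (tri C (insert k S)).card = (tri C S).card + 1) :
    tri C (insert k S) = addMin (tri C S) C := by
  have hkS : k ∉ S := fun h => lt_irrefl _ (hk k h)
  have e1 : addMin S (insert k S ∪ C) = insert k S :=
    addMin_eq (by simp) hkS fun x hx _ => by
      simp only [Finset.mem_union, Finset.mem_insert] at hx
      rcases hx with (rfl | hx) | hx
      · exact le_rfl
      · exact (hk x hx).le
      · exact hC x hx
  have e2 : tri C (insert k S ∪ C) = C :=
    (tri_subset _ _).antisymm fun c hc =>
      mem_tri.mpr ⟨hc, c, le_rfl, countIcc_mono Finset.subset_union_right _ _⟩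
  have := tri_addMin (C := C) (S := S) (T := insert k S ∪ C) (fun x hx => by simp [hx])
    (by rw [e1]; exact h1)
  rw [e1, e2] at this
  exact this

/-- All cars start above the new spot, so none can use it. -/
theorem tri_insert_left {C S : Finset ℕ} {k : ℕ} (hk : ∀ x ∈ S, k < x) (hC : k ∉ C) :
    tri (insert k C) S = tri C S := by
  have hz : ∀ a, countIcc S a k = 0 := by
    intro a
    rw [countIcc, Finset.card_eq_zero, Finset.eq_empty_iff_forall_notMem]
    intro x hx
    simp only [Finset.mem_inter, Finset.mem_Icc] at hx
    have := hk x hx.1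
    omega
  ext c
  rw [mem_tri, mem_tri, Finset.mem_insert]
  constructor
  · rintro ⟨rfl | hc, a, ha, h⟩
    · rw [hz, countIcc_insert hC, if_pos ⟨ha, le_rfl⟩] at h
      omega
    · exact ⟨hc, a, ha, (countIcc_mono (Finset.subset_insert _ _) _ _).trans h⟩
  · rintro ⟨hc, a, ha, h⟩
    -- Cutting the interval off above `k` loses no car and excludes the spot `k`.
    refine ⟨.inr hc, max a (k + 1), ?_, ?_⟩
    · by_contra hck
      have hck : c ≤ k := by omega
      have h0 : countIcc S a c = 0 := by
        have := hz a
        have h2 : countIcc S a c ≤ countIcc S a k :=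
          Finset.card_le_card (Finset.inter_subset_inter_left (Finset.Icc_subset_Icc le_rfl hck))
        omega
      have := countIcc_pos hc ha le_rfl
      omega
    · rw [countIcc_insert hC, if_neg (by omega), add_zero]
      have h1 : countIcc C (max a (k + 1)) c ≤ countIcc C a c :=
        Finset.card_le_card (Finset.inter_subset_inter_left
          (Finset.Icc_subset_Icc (le_max_left _ _) le_rfl))
      have h2 : countIcc S a c = countIcc S (max a (k + 1)) c := by
        unfold countIcc
        congr 1
        ext x
        simp only [Finset.mem_inter, Finset.mem_Icc]
        have := hk x
        grind
      omega


/-! ### Transfer operators -/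

/-- The factor `1 + β x` attached to a column that receives no new letter and is longer than the next
one; `A` is the next key column, `B'` and `B` are the old and the new key column. -/
noncomputable def corner (x : R) (B B' A : Finset ℕ) : R :=
  if B = B' ∧ A ≠ B' then 1 + beta * x else 1

/-- The transfer operator that adds a letter with variable `x` to a list of key columns; `B'` and `B`
are the old and the new version of the column to the left of the list.  The formal sum of the
resulting lists is represented by the linear functional `F ↦ row x B B' As F`. -/
noncomputable def row (x : R) (B B' : Finset ℕ) :
    List (Finset ℕ) → (List (Finset ℕ) → R) → R
  | [], F => corner x B B' ∅ * F []
  | A :: As, F => corner x B B' A * (row x A A As (fun L => F (A :: L)) +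
      if A = B then 0
      else x * row x (addMin A B) A As (fun L => F (addMin A B :: L)))

theorem row_add (x : R) (B B' : Finset ℕ) (As : List (Finset ℕ)) (F G : List (Finset ℕ) → R) :
    row x B B' As (fun L => F L + G L) = row x B B' As F + row x B B' As G := by
  induction As generalizing B B' F G with
  | nil => simp only [row]; ring
  | cons A As ih =>
    simp only [row, ih]
    split_ifs <;> ring

theorem row_mul (x : R) (B B' : Finset ℕ) (As : List (Finset ℕ)) (c : R)
    (F : List (Finset ℕ) → R) :
    row x B B' As (fun L => c * F L) = c * row x B B' As F := by
  induction As generalizing B B' F with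
  | nil => simp only [row]; ring
  | cons A As ih =>
    simp only [row, ih]
    split_ifs <;> ring

theorem map_corner {x : R} {s : R →+* R} (hβ : s beta = beta) (B B' A : Finset ℕ) :
    s (corner x B B' A) = corner (s x) B B' A := by
  unfold corner
  split_ifs <;> simp [hβ]

theorem map_row {x : R} {s : R →+* R} (hβ : s beta = beta) (B B' : Finset ℕ)
    (As : List (Finset ℕ)) (F : List (Finset ℕ) → R) :
    s (row x B B' As F) = row (s x) B B' As (fun L => s (F L)) := by
  induction As generalizing B B' F with
  | nil => simp [row, map_corner hβ]
  | cons A As ih =>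
    simp only [row, map_mul, map_add, map_corner hβ, ih]
    split_ifs <;> simp [ih]

/-- A weakly decreasing chain of sets, each contained in `B`. -/
abbrev ChainIn (B : Finset ℕ) (L : List (Finset ℕ)) : Prop := List.IsChain (· ⊇ ·) (B :: L)

theorem subset_addMin (A B : Finset ℕ) : A ⊆ addMin A B := by
  unfold addMin
  split_ifs
  · exact Finset.subset_insert _ _
  · exact subset_rfl

theorem addMin_subset {A B : Finset ℕ} (h : A ⊆ B) : addMin A B ⊆ B := by
  by_cases hBA : B ⊆ A
  · rwa [addMin_of_subset hBA]
  · obtain ⟨m, hm, -, -, e⟩ := exists_addMin hBA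
    rw [e]
    exact Finset.insert_subset hm h

/-- `addMin A B` lies between `A` and `B`, so a row evaluates its continuation only at chains inside
`B`. -/
theorem row_congr {x : R} {B B' : Finset ℕ} {As : List (Finset ℕ)} {F G : List (Finset ℕ) → R}
    (hB : B' ⊆ B) (hA : ChainIn B' As) (h : ∀ L, ChainIn B L → F L = G L) :
    row x B B' As F = row x B B' As G := by
  induction As generalizing B B' F G with
  | nil => simp only [row, h [] (List.isChain_singleton _)]
  | cons A As ih =>
    rw [ChainIn, List.isChain_cons_cons] at hA
    have hAB : A ⊆ B := hA.1.trans hB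
    simp only [row]
    rw [ih subset_rfl hA.2 fun L hL => h _ (List.isChain_cons_cons.mpr ⟨hAB, hL⟩),
      ih (subset_addMin A B) hA.2 fun L hL =>
        h _ (List.isChain_cons_cons.mpr ⟨addMin_subset hAB, hL⟩)]

theorem addMin_insert_of_lt {A B : Finset ℕ} {a : ℕ} (ha : a ∉ A)
    (h : ∀ x ∈ B, x ∉ A → a < x) : addMin A (insert a B) = insert a A :=
  addMin_eq (by simp) ha (by grind)

theorem addMin_insert_of_gt {A B : Finset ℕ} {a d : ℕ} (hB : d ∈ B) (hA : d ∉ A)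
    (hm : ∀ x ∈ B, x ∉ A → d ≤ x) (h : d < a) : addMin A (insert a B) = insert d A :=
  addMin_eq (by simp [hB]) hA (by grind)

theorem addMin_insert_insert {A B : Finset ℕ} {a u : ℕ} (hB : u ∈ B) (hA : u ∉ A)
    (hm : ∀ x ∈ B, x ∉ A → u ≤ x) (ha : a ∉ A) (h : a < u) :
    addMin (insert a A) (insert a B) = insert a (insert u A) ∧
    addMin (insert u A) (insert a B) = insert a (insert u A) := by
  constructor
  · rw [Finset.insert_comm a u A]
    exact addMin_eq (by simp [hB]) (by grind) (by grind)
  · exact addMin_eq (by simp) (by grind) (by grind)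

theorem exists_addMin_insert {A B : Finset ℕ} {d : ℕ} (hm : ∀ x ∈ B, x ∉ A → d ≤ x)
    (h : ¬ B ⊆ insert d A) :
    ∃ e, e ∉ A ∧ d < e ∧ addMin (insert d A) B = insert d (insert e A) := by
  obtain ⟨e, heB, heA, -, he⟩ := exists_addMin h
  rw [Finset.insert_comm] at he
  exact ⟨e, by grind, by grind, he⟩

theorem insert_ne_of_notMem {A B : Finset ℕ} {u a : ℕ} (hA : a ∉ A) (hu : a ≠ u) (hB : a ∈ B) :
    insert u A ≠ B := by
  rintro rfl
  simp_all

/-! ### Exchange relations for two consecutive rows -/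

/-- Two consecutive rows. -/
noncomputable def twoRow (x y : R) (B₀ B₁ B₂ : Finset ℕ) (As : List (Finset ℕ))
    (F : List (Finset ℕ) → R) : R :=
  row x B₁ B₀ As fun L => row y B₂ B₁ L F

theorem twoRow_nil (x y : R) (B₀ B₁ B₂ : Finset ℕ) (F : List (Finset ℕ) → R) :
    twoRow x y B₀ B₁ B₂ [] F = corner x B₁ B₀ ∅ * (corner y B₂ B₁ ∅ * F []) := rfl

/-- By linearity of `row` in the continuation, the choices at the first column separate: no new
letter, one from the second row, one from the first row, or one from each. -/
theorem twoRow_cons (x y : R) (B₀ B₁ B₂ A : Finset ℕ) (As : List (Finset ℕ))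
    (F : List (Finset ℕ) → R) :
    twoRow x y B₀ B₁ B₂ (A :: As) F = corner x B₁ B₀ A * (
      corner y B₂ B₁ A * (twoRow x y A A A As (fun L => F (A :: L)) +
        if A = B₂ then 0 else
          y * twoRow x y A A (addMin A B₂) As (fun L => F (addMin A B₂ :: L))) +
      if A = B₁ then 0 else x * (corner y B₂ B₁ (addMin A B₁) *
        (twoRow x y A (addMin A B₁) (addMin A B₁) As (fun L => F (addMin A B₁ :: L)) +
        if addMin A B₁ = B₂ then 0 else
          y * twoRow x y A (addMin A B₁) (addMin (addMin A B₁) B₂) As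
            (fun L => F (addMin (addMin A B₁) B₂ :: L))))) := by
  have key : ∀ A' B, row x B A As (fun L => row y B₂ B₁ (A' :: L) F) = corner y B₂ B₁ A' *
      (row x B A As (fun L => row y A' A' L (fun L => F (A' :: L))) +
        if A' = B₂ then 0 else y * row x B A As (fun L =>
          row y (addMin A' B₂) A' L (fun L => F (addMin A' B₂ :: L)))) := by
    intro A' B
    simp only [row]
    split_ifs <;> simp only [row_mul, row_add, add_zero]
  simp only [twoRow, row] at key ⊢
  rw [key, key]

set_option maxHeartbeats 1000000 in
/-- The relations between two consecutive rows; `s` exchanges the variables of the rows. -/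
theorem twoRow_relations {x y : R} (hxy : x ≠ y) {s : R →+* R} (hx : s x = y) (hy : s y = x)
    (hβ : s beta = beta) (hs : ∀ f, s (s f) = f) (As : List (Finset ℕ)) :
    ∀ (B : Finset ℕ) (F : List (Finset ℕ) → R), ChainIn B As → (∀ L, s (F L) = F L) →
    s (twoRow x y B B B As F) = twoRow x y B B B As F ∧
    (∀ a ∉ B, (x - y) * twoRow x y B (insert a B) (insert a B) As F = (1 + beta * y) *
      (x * s (twoRow x y B B (insert a B) As F) - y * twoRow x y B B (insert a B) As F)) ∧
    (∀ a b, a ∉ B → b ∉ B → a < b → (x - y) * twoRow x y B (insert a B) (insert a (insert b B)) As F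
      = (1 + beta * y) * x * s (twoRow x y B (insert b B) (insert a (insert b B)) As F)
      - (1 + beta * x) * y * twoRow x y B (insert b B) (insert a (insert b B)) As F) := by
  induction As with
  | nil =>
    intro B F _ hF
    refine ⟨?_, fun a ha => ?_, fun a b ha hb hab => ?_⟩
    · by_cases h : B = ∅
      · simp [twoRow_nil, corner, h, hF]
      · simp [twoRow_nil, corner, Ne.symm h, hF, hβ, hx, hy]
        ring
    · have h1 : insert a B ≠ B := fun h => ha (h ▸ Finset.mem_insert_self _ _)
      have h2 : insert a B ≠ ∅ := Finset.insert_ne_empty _ _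
      by_cases h : B = ∅
      · simp [twoRow_nil, corner, h, hF]
        ring
      · simp [twoRow_nil, corner, Ne.symm h, Ne.symm h2, h1, hF, hβ, hx]
        ring
    · have h1 : insert a B ≠ B := fun h => ha (h ▸ Finset.mem_insert_self _ _)
      have h2 : insert b B ≠ B := fun h => hb (h ▸ Finset.mem_insert_self _ _)
      have h3 : insert a (insert b B) ≠ insert a B := by
        intro h
        have : b ∈ insert a B := h ▸ by simp
        simp only [Finset.mem_insert, hb, or_false] at this
        omega
      have h4 : insert a (insert b B) ≠ insert b B := by
        intro h
        have : a ∈ insert b B := h ▸ by simp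
        simp only [Finset.mem_insert, ha, or_false] at this
        omega
      simp [twoRow_nil, corner, h1, h2, h3, h4, hF]
      ring
  | cons A As ih =>
    intro B F hA hF
    rw [ChainIn, List.isChain_cons_cons] at hA
    obtain ⟨hAB, hA⟩ := hA
    have hF' : ∀ A' L, s (F (A' :: L)) = F (A' :: L) := fun A' L => hF _
    have hd : x - y ≠ 0 := sub_ne_zero.mpr hxy
    have I1 : ∀ A', s (twoRow x y A A A As fun L => F (A' :: L))
        = twoRow x y A A A As fun L => F (A' :: L) := fun A' => (ih A _ hA (hF' A')).1
    have I2 : ∀ A', ∀ a ∉ A, _ := fun A' => (ih A _ hA (hF' A')).2.1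
    have I3 : ∀ A', ∀ a b, a ∉ A → b ∉ A → a < b → _ := fun A' => (ih A _ hA (hF' A')).2.2
    -- The right side of the second relation is `1 + βy` times an antisymmetric expression. So its
    -- left side divided by `(x - y)(1 + βy)` is symmetric.
    have I2' : ∀ A', ∀ a ∉ A,
        (1 + beta * y) * s (twoRow x y A (insert a A) (insert a A) As fun L => F (A' :: L))
        = (1 + beta * x) * twoRow x y A (insert a A) (insert a A) As fun L => F (A' :: L) := by
      intro A' a ha
      have h := I2 A' a ha
      have h' := congrArg s h
      simp only [map_mul, map_sub, map_add, map_one, hx, hy, hβ, hs] at h'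
      refine mul_left_cancel₀ hd ?_
      linear_combination (-(1 + beta * y)) * h' - (1 + beta * x) * h
    -- The right side of the third relation is antisymmetric, as is `x - y`.
    have I3' : ∀ A', ∀ a b, a ∉ A → b ∉ A → a < b →
        s (twoRow x y A (insert a A) (insert a (insert b A)) As fun L => F (A' :: L))
        = twoRow x y A (insert a A) (insert a (insert b A)) As fun L => F (A' :: L) := by
      intro A' a b ha hb hab
      have h := I3 A' a b ha hb hab
      have h' := congrArg s h
      simp only [map_mul, map_sub, map_add, map_one, hx, hy, hβ, hs] at h'
      refine mul_left_cancel₀ hd ?_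
      linear_combination - h' - h
    by_cases hD : A = B
    · subst hD
      refine ⟨?_, fun a ha => ?_, fun a b ha hb hab => ?_⟩
      · simp [twoRow_cons, corner, I1]
      · have h1 : insert a A ≠ A := fun h => ha (h ▸ Finset.mem_insert_self _ _)
        have m1 : addMin A (insert a A) = insert a A := addMin_eq (by simp) ha (by grind)
        have := I2 (insert a A) a ha
        simp [twoRow_cons, corner, I1, h1, h1.symm, m1, hy]
        linear_combination x * this
      · have haN : a ∉ insert b A := by simp [ha, hab.ne]
        have hbN : b ∉ insert a A := by simp [hb, hab.ne']
        have h1 : insert a A ≠ A := fun h => ha (h ▸ Finset.mem_insert_self _ _)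
        have h2 : insert b A ≠ A := fun h => hb (h ▸ Finset.mem_insert_self _ _)
        have h3 : insert a (insert b A) ≠ insert a A := fun h => hbN (h ▸ by simp)
        have h4 : insert a (insert b A) ≠ insert b A := fun h => haN (h ▸ by simp)
        have h5 : A ≠ insert a (insert b A) := fun h => ha (h ▸ by simp)
        have m1 : addMin A (insert a A) = insert a A := addMin_insert_of_lt ha (by simp_all)
        have m2 : addMin A (insert b A) = insert b A := addMin_insert_of_lt hb (by simp_all)
        have m3 : addMin A (insert a (insert b A)) = insert a A :=
          addMin_insert_of_lt ha (by simp_all)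
        obtain ⟨m4, m5⟩ := addMin_insert_insert (A := A) (B := insert b A)
          (Finset.mem_insert_self b A) hb (by simp_all) ha hab
        have j1 := I2 (insert a A) a ha
        have j2 := I2' (insert b A) b hb
        have j3 := I3 (insert a (insert b A)) a b ha hb hab
        simp [twoRow_cons, corner, I1, h1, h2, h3, h3.symm, h4.symm, h1.symm, h2.symm, h5, m1, m2,
          m3, m4, m5, ha, hab.ne, hx, hy]
        linear_combination x * j1 - x * y * j2 + x * y * j3
    -- `d` is the letter that `A` gains next to the left neighbour `B`.
    · obtain ⟨d, hdB, hdA, hdm, hdE⟩ := exists_addMin fun h => hD (hAB.antisymm h)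
      refine ⟨?_, fun a ha => ?_, fun a b ha hb hab => ?_⟩
      · have j2 := I2 (insert d A) d hdA
        have j3 := congrArg s j2
        simp only [map_mul, map_sub, map_add, map_one, hx, hy, hβ, hs] at j3
        -- If `A ∪ {d} = B`, there is no room for a second letter; otherwise the second letter is
        -- some `e > d`, and that term is symmetric by `I3'`.
        by_cases hE : insert d A = B
        · simp only [twoRow_cons, corner, I1, hD, hdE, hE, hx, hy, hβ, map_mul, map_add, map_one,
            ne_eq, not_true, not_false_eq_true, and_true, and_false, if_true, if_false, add_zero,
            one_mul]
          rw [hE] at j2 j3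
          refine mul_left_cancel₀ hd ?_
          linear_combination (-(1 + beta * x)) * x * j2 - (1 + beta * y) * y * j3
        · obtain ⟨e, heA, hde, heE⟩ := exists_addMin_insert hdm fun h =>
            hE ((Finset.insert_subset hdB hAB).antisymm h)
          have j4 := I3' (insert d (insert e A)) d e hdA heA hde
          simp only [twoRow_cons, corner, I1, hD, hdE, hE, heE, hx, hy, hβ, j4, map_mul, map_add,
            map_one, ne_eq, not_false_eq_true, and_true, if_true, if_false]
          refine mul_left_cancel₀ hd ?_
          linear_combination (-(1 + beta * x)) * (1 + beta * y) * x * j2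
            - (1 + beta * y) * (1 + beta * x) * y * j3
      · have haA : a ∉ A := fun h => ha (hAB h)
        have had : a ≠ d := fun h => ha (h ▸ hdB)
        have h1 : A ≠ insert a B := fun h => haA (h ▸ by simp)
        have h2 : insert a B ≠ B := fun h => ha (h ▸ by simp)
        have h3 : insert d A ≠ insert a B := insert_ne_of_notMem haA had (by simp)
        -- If `a < d`, then `A` gains `a` or `d` first, according to whether its left neighbour
        -- already has `a`. If `d < a`, it gains `d` first in either case.
        rcases lt_or_gt_of_ne had with hlt | hlt
        · have h4 : insert a A ≠ insert a B := insert_ne_of_notMem hdA had.symm (by simp [hdB])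
          have m1 : addMin A (insert a B) = insert a A :=
            addMin_insert_of_lt haA fun x hx hx' => hlt.trans_le (hdm x hx hx')
          obtain ⟨m2, m3⟩ := addMin_insert_insert hdB hdA hdm haA hlt
          have j1 := I2 (insert a A) a haA
          have j2 := I2' (insert d A) d hdA
          have j3 := I3 (insert a (insert d A)) a d haA hdA hlt
          simp [twoRow_cons, corner, I1, hD, h1, h2, h3, h4, m1, m2, m3, hdE, hx, hy, hβ]
          linear_combination (1 + beta * y) * (x * j1 - x * y * j2 + x * y * j3)
        · have m1 : addMin A (insert a B) = insert d A := addMin_insert_of_gt hdB hdA hdm hlt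
          obtain ⟨e, heA, hde, heE⟩ := exists_addMin_insert
            (A := A) (B := insert a B) (d := d) (by grind) fun h => by
              have := h (Finset.mem_insert_self a B)
              simp_all
          have j2 := I2 (insert d A) d hdA
          have j3 := congrArg s j2
          simp only [map_mul, map_sub, map_add, map_one, hx, hy, hβ, hs] at j3
          have j4 := I3' (insert d (insert e A)) d e hdA heA hde
          -- In this combination the terms with `β` cancel, so that the second relation makes it
          -- symmetric.
          have j5 : s (y * twoRow x y A A (insert d A) As (fun L => F (insert d A :: L)) +
              x * twoRow x y A (insert d A) (insert d A) As (fun L => F (insert d A :: L))) =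
              y * twoRow x y A A (insert d A) As (fun L => F (insert d A :: L)) +
              x * twoRow x y A (insert d A) (insert d A) As (fun L => F (insert d A :: L)) := by
            refine mul_left_cancel₀ hd ?_
            simp only [map_mul, map_add, hx, hy]
            linear_combination - x * j2 - y * j3
          simp only [map_mul, map_add, hx, hy] at j5
          simp [twoRow_cons, corner, I1, hD, h1, h2, h3, m1, heE, hdE, hx, hy, hβ, j4]
          linear_combination (-(1 + beta * y)) * x * (1 + beta * y) * j5
      · have haA : a ∉ A := fun h => ha (hAB h)
        have hbA : b ∉ A := fun h => hb (hAB h)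
        have had : a ≠ d := fun h => ha (h ▸ hdB)
        have haN : a ∉ insert b B := by simp [ha, hab.ne]
        have hbN : b ∉ insert a B := by simp [hb, hab.ne']
        have h3 : insert a (insert b B) ≠ insert a B := fun h => hbN (h ▸ by simp)
        have h5 : A ≠ insert a (insert b B) := fun h => haA (h ▸ by simp)
        have h6 : A ≠ insert a B := fun h => haA (h ▸ by simp)
        have h7 : A ≠ insert b B := fun h => hbA (h ▸ by simp)
        have h8 : ∀ u, insert u A ≠ insert a (insert b B) := fun u h => by
          by_cases hu : a = u
          · exact insert_ne_of_notMem hbA (hu ▸ hab.ne') (by simp) h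
          · exact insert_ne_of_notMem haA hu (by simp) h
        rcases lt_or_gt_of_ne had with hlt | hlt
        · have hlt' : ∀ x ∈ insert b B, x ∉ A → a < x := by
            intro x hx hx'
            rcases Finset.mem_insert.mp hx with rfl | hx
            · exact hab
            · exact hlt.trans_le (hdm x hx hx')
          have m1 : addMin A (insert a B) = insert a A :=
            addMin_insert_of_lt haA fun x hx hx' => hlt' x (Finset.mem_insert_of_mem hx) hx'
          have m2 : addMin A (insert a (insert b B)) = insert a A := addMin_insert_of_lt haA hlt'
          obtain ⟨u, huB, huA, hum, huE⟩ := exists_addMin (A := A) (B := insert b B) fun h =>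
            hbA (h (Finset.mem_insert_self b B))
          have hau : a < u := hlt' u huB huA
          obtain ⟨m3, m4⟩ := addMin_insert_insert huB huA hum haA hau
          have j1 := I2 (insert a A) a haA
          have j2 := I2' (insert u A) u huA
          have j3 := I3 (insert a (insert u A)) a u haA huA hau
          simp [twoRow_cons, corner, I1, ha, hb, hab.ne, h3, h5, h6, h7, h8, m1, m2, m3, m4, huE,
            hx, hy]
          linear_combination x * j1 - x * y * j2 + x * y * j3
        · have m1 : addMin A (insert a B) = insert d A := addMin_insert_of_gt hdB hdA hdm hlt
          have m2 : addMin A (insert b B) = insert d A :=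
            addMin_insert_of_gt hdB hdA hdm (hlt.trans hab)
          have hdm' : ∀ x ∈ insert b B, x ∉ A → d ≤ x := by
            intro x hx hx'
            rcases Finset.mem_insert.mp hx with rfl | hx
            · exact (hlt.trans hab).le
            · exact hdm x hx hx'
          have m3 : addMin A (insert a (insert b B)) = insert d A :=
            addMin_insert_of_gt (by simp [hdB]) hdA hdm' hlt
          obtain ⟨e, heA, hde, heE⟩ := exists_addMin_insert
            (A := A) (B := insert a (insert b B)) (d := d) (by
              intro x hx hx'
              rcases Finset.mem_insert.mp hx with rfl | hx
              · exact hlt.le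
              · exact hdm' x hx hx') fun h => by
              have := h (Finset.mem_insert_self a _)
              simp_all
          have j2 := I2 (insert d A) d hdA
          have j4 := I3' (insert d (insert e A)) d e hdA heA hde
          have j5 := I2' (insert d A) d hdA
          simp [twoRow_cons, corner, I1, ha, hb, hab.ne, h3, h5, h6, h7, h8, m1, m2, m3, heE, hx,
            hy, j4]
          linear_combination x * j2 - x * y * j5


/-! ### Sorting two adjacent letters in a key -/

/-- Replace `i + 1` by `i` if only `i + 1` is present. -/
def shift (i : ℕ) (K : Finset ℕ) : Finset ℕ :=
  if i + 1 ∈ K ∧ i ∉ K then insert i (K.erase (i + 1)) else K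

theorem mem_shift {i j : ℕ} {K : Finset ℕ} : j ∈ shift i K ↔
    (j = i ∧ (i ∈ K ∨ i + 1 ∈ K)) ∨ (j = i + 1 ∧ i ∈ K ∧ i + 1 ∈ K) ∨
      (j ≠ i ∧ j ≠ i + 1 ∧ j ∈ K) := by
  unfold shift
  split_ifs with h
  · simp only [Finset.mem_insert, Finset.mem_erase]
    grind
  · grind

theorem shift_mono (i : ℕ) {A B : Finset ℕ} (h : A ⊆ B) : shift i A ⊆ shift i B := by
  intro j
  rw [mem_shift, mem_shift]
  have h1 := @h i
  have h2 := @h (i + 1)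
  have h3 := @h j
  tauto

theorem card_shift (i : ℕ) (K : Finset ℕ) : (shift i K).card = K.card := by
  unfold shift
  split_ifs with h
  · rw [Finset.card_insert_of_notMem (by simp [h.2]), Finset.card_erase_add_one h.1]
  · rfl

theorem shift_eq_shift_iff (i : ℕ) {A B : Finset ℕ} (h : A ⊆ B) :
    shift i A = shift i B ↔ A = B := by
  refine ⟨fun he => Finset.eq_of_subset_of_card_le h ?_, fun he => he ▸ rfl⟩
  rw [← card_shift i A, ← card_shift i B, he]

theorem shift_of_mem {i : ℕ} {K : Finset ℕ} (h : i ∈ K) : shift i K = K :=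
  if_neg fun hh => hh.2 h

theorem shift_of_notMem {i : ℕ} {K : Finset ℕ} (h : i + 1 ∉ K) : shift i K = K :=
  if_neg fun hh => h hh.1

/-- In a nested pair, `shift i` alters the two sets compatibly; only the name of the added letter
can change, from `i` to `i + 1` or back. -/
theorem shift_addMin (i : ℕ) {A B : Finset ℕ} (hAB : A ⊆ B) :
    shift i (addMin A B) = addMin (shift i A) (shift i B) := by
  by_cases hBA : B ⊆ A
  · rw [addMin_of_subset hBA, addMin_of_subset (shift_mono i hBA)]
  obtain ⟨m, hmB, hmA, hmin, e⟩ := exists_addMin hBA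
  rw [e]
  have h0 := @hAB i
  have h1 := @hAB (i + 1)
  have m0 := hmin i
  have m1 := hmin (i + 1)
  suffices ∃ m', m' ∈ shift i B ∧ m' ∉ shift i A ∧
      (∀ x ∈ shift i B, x ∉ shift i A → m' ≤ x) ∧ shift i (insert m A) = insert m' (shift i A) by
    obtain ⟨m', h1, h2, h3, h4⟩ := this
    rw [h4, addMin_eq h1 h2 h3]
  -- If `m = i` joins `i + 1 ∈ A`, then `shift i A` already contains `i` and lacks `i + 1`. If `m =
  -- i + 1` is added to a set without `i`, it is renamed `i`.
  refine ⟨if m = i ∧ i + 1 ∈ A then i + 1 else if m = i + 1 ∧ i ∉ A then i else m, ?_, ?_, ?_, ?_⟩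
  · rw [mem_shift]
    split_ifs <;> grind
  · rw [mem_shift]
    split_ifs <;> grind
  · intro x
    have := hmin x
    rw [mem_shift, mem_shift]
    split_ifs <;> grind
  · ext x
    rw [Finset.mem_insert, mem_shift, mem_shift]
    simp only [Finset.mem_insert]
    split_ifs <;> grind

theorem corner_shift (x : R) (i : ℕ) {B B' A : Finset ℕ} (hB : B' ⊆ B) (hA : A ⊆ B') :
    corner x (shift i B) (shift i B') (shift i A) = corner x B B' A := by
  unfold corner
  have h : shift i B = shift i B' ↔ B = B' := by
    rw [eq_comm, shift_eq_shift_iff i hB, eq_comm]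
  simp only [h, ne_eq, shift_eq_shift_iff i hA]

/-- Every ingredient of a row is preserved: `shift i` commutes with `addMin`, and it keeps equality
and inequality of nested sets. -/
theorem row_shift (x : R) (i : ℕ) {B B' : Finset ℕ} {As : List (Finset ℕ)}
    (F : List (Finset ℕ) → R) (hB : B' ⊆ B) (hA : ChainIn B' As) :
    row x (shift i B) (shift i B') (As.map (shift i)) F
      = row x B B' As fun L => F (L.map (shift i)) := by
  induction As generalizing B B' F with
  | nil =>
    have := corner_shift x i hB (Finset.empty_subset B')
    rw [shift_of_notMem (Finset.notMem_empty (i + 1))] at this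
    simp only [row, List.map_nil, this]
  | cons A As ih =>
    rw [ChainIn, List.isChain_cons_cons] at hA
    have hAB : A ⊆ B := hA.1.trans hB
    simp only [row, List.map_cons]
    rw [corner_shift x i hB hA.1, ih _ subset_rfl hA.2, ← shift_addMin i hAB,
      ih _ (subset_addMin A B) hA.2]
    simp only [shift_eq_shift_iff i hAB]

/-! ### The generating function of all tableaux -/

theorem piBeta_eq_of_spec {i : ℕ} {f g : R} (h : (X i - X (i + 1) : R) * g
    = (1 + beta * X (i + 1)) * X i * f - (1 + beta * X i) * X (i + 1) * sPoly i f) :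
    piBeta i f = g :=
  mul_left_cancel₀ (X_sub_X_ne_zero (by omega)) ((piBeta_spec i f).trans h.symm)

theorem piBeta_add (i : ℕ) (f g : R) : piBeta i (f + g) = piBeta i f + piBeta i g := by
  refine piBeta_eq_of_spec ?_
  rw [map_add]
  linear_combination piBeta_spec i f + piBeta_spec i g

theorem piBeta_mul (i : ℕ) {c : R} (hc : sPoly i c = c) (f : R) :
    piBeta i (c * f) = c * piBeta i f := by
  refine piBeta_eq_of_spec ?_
  rw [map_mul, hc]
  linear_combination c * piBeta_spec i f

theorem sPoly_corner {i : ℕ} {x : R} (hx : sPoly i x = x) (B B' A : Finset ℕ) :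
    sPoly i (corner x B B' A) = corner x B B' A := by
  have := map_corner (s := (sPoly i).toRingHom) (x := x) (sPoly_beta i) B B' A
  simpa [hx] using this

/-- A row whose variable is fixed by `s_i` is linear over scalars that commute with `π_i`. -/
theorem piBeta_row {i : ℕ} {x : R} (hx : sPoly i x = x) (B B' : Finset ℕ)
    (As : List (Finset ℕ)) (F : List (Finset ℕ) → R) :
    piBeta i (row x B B' As F) = row x B B' As fun L => piBeta i (F L) := by
  induction As generalizing B B' F with
  | nil => simp only [row, piBeta_mul i (sPoly_corner hx _ _ _)]
  | cons A As ih =>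
    simp only [row, piBeta_mul i (sPoly_corner hx _ _ _), piBeta_add, ih]
    split_ifs
    · rw [← zero_mul (0 : R), piBeta_mul i (map_zero _)]
      ring
    · rw [piBeta_mul i hx, ih]

/-! ### Isobaric operators acting on the product of all rows -/

/-- Rows for the letters `k - 1, …, 0`, applied to a list of key columns with letters in
`[k, n)`. -/
noncomputable def rows (n : ℕ) : ℕ → List (Finset ℕ) → (List (Finset ℕ) → R) → R
  | 0, L, F => F L
  | k + 1, L, F => row (X k) (Finset.Ico k n) (Finset.Ico (k + 1) n) L fun L' => rows n k L' F

theorem Ico_succ_subset (k n : ℕ) : Finset.Ico (k + 1) n ⊆ Finset.Ico k n :=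
  Finset.Ico_subset_Ico (Nat.le_succ k) le_rfl

theorem sPoly_rows {i n k : ℕ} (hk : k ≤ i) (L : List (Finset ℕ)) {F : List (Finset ℕ) → R}
    (hF : ∀ L, sPoly i (F L) = F L) : sPoly i (rows n k L F) = rows n k L F := by
  induction k generalizing L with
  | zero => exact hF L
  | succ k ih =>
    have := map_row (s := (sPoly i).toRingHom) (x := X k) (sPoly_beta i) (Finset.Ico k n)
      (Finset.Ico (k + 1) n) L (fun L' => rows n k L' F)
    simp only [AlgHom.toRingHom_eq_coe, RingHom.coe_coe,
      sPoly_X_of_ne (show k ≠ i by omega) (show k ≠ i + 1 by omega), ih (by omega)] at this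
    exact this

/-- For letters below `i` the boundary columns contain `i`, so `shift i` fixes them and passes
through the rows. -/
theorem rows_shift {i n k : ℕ} (hk : k ≤ i) (hi : i + 1 < n) {L : List (Finset ℕ)}
    (hL : ChainIn (Finset.Ico k n) L) (F : List (Finset ℕ) → R) :
    rows n k (L.map (shift i)) F = rows n k L fun L => F (L.map (shift i)) := by
  induction k generalizing L with
  | zero => rfl
  | succ k ih =>
    have h1 := row_shift (X k) i (fun L' => rows n k L' F) (Ico_succ_subset k n) hL
    rw [shift_of_mem (by simp; omega), shift_of_mem (by simp; omega)] at h1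
    rw [rows, h1]
    exact row_congr (Ico_succ_subset k n) hL fun L' hL' => ih (by omega) hL'

/-- `π_i` passes the rows of the letters above `i + 1`. At the rows of `i + 1` and `i` the third
exchange relation turns it into `shift i` on the intermediate key columns, which is then carried to
the end. -/
theorem piBeta_rows {i n k : ℕ} (hk : i + 2 ≤ k) (hi : i + 1 < n) {L : List (Finset ℕ)}
    (hL : ChainIn (Finset.Ico k n) L) {F : List (Finset ℕ) → R}
    (hF : ∀ L, sPoly i (F L) = F L) :
    piBeta i (rows n k L F) = rows n k L fun L => F (L.map (shift i)) := by
  induction k, hk using Nat.le_induction generalizing L with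
  | base =>
    have hb : i + 1 ∉ Finset.Ico (i + 2) n := by simp
    have ha : i ∉ Finset.Ico (i + 2) n := by simp
    have e1 : Finset.Ico (i + 1) n = insert (i + 1) (Finset.Ico (i + 2) n) := by
      ext x
      simp only [Finset.mem_insert, Finset.mem_Ico]
      omega
    have e2 : Finset.Ico i n = insert i (Finset.Ico (i + 1) n) := by
      ext x
      simp only [Finset.mem_insert, Finset.mem_Ico]
      omega
    have e3 : shift i (Finset.Ico (i + 1) n) = insert i (Finset.Ico (i + 2) n) := by
      ext x
      simp only [mem_shift, Finset.mem_insert, Finset.mem_Ico]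
      omega
    -- Before the row of the letter `i + 1`, no column contains `i` or `i + 1`.
    have e4 : L.map (shift i) = L := by
      refine (List.map_congr_left (g := id) fun K hK => shift_of_notMem fun h => ?_).trans
        (List.map_id L)
      have := (List.pairwise_cons.mp (List.isChain_iff_pairwise.mp hL)).1 K hK h
      simp at this
    have key := (twoRow_relations (x := X (i + 1)) (y := X i) (s := (sPoly i).toRingHom)
      (fun h => by have := X_injective h; omega) (sPoly_X_right i) (sPoly_X_left i)
      (sPoly_beta i) (sPoly_sPoly i) L (Finset.Ico (i + 2) n) (fun L' => rows n i L' F) hL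
      -- The relation is taken with `a = i` and `b = i + 1`, the boundary being `[i + 2, n)`; the
      -- remaining rows have variables fixed by `s_i`.
      (fun L' => sPoly_rows le_rfl L' hF)).2.2 i (i + 1) ha hb (Nat.lt_succ_self i)
    rw [← e1, ← e2] at key
    have h1 : piBeta i (rows n (i + 2) L F) = twoRow (X (i + 1)) (X i) (Finset.Ico (i + 2) n)
        (insert i (Finset.Ico (i + 2) n)) (Finset.Ico i n) L (fun L' => rows n i L' F) := by
      refine piBeta_eq_of_spec ?_
      change _ = _ * twoRow (X (i + 1)) (X i) (Finset.Ico (i + 2) n) (Finset.Ico (i + 1) n)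
        (Finset.Ico i n) L (fun L' => rows n i L' F) - _ * sPoly i (twoRow (X (i + 1)) (X i)
        (Finset.Ico (i + 2) n) (Finset.Ico (i + 1) n) (Finset.Ico i n) L
        (fun L' => rows n i L' F))
      simp only [AlgHom.toRingHom_eq_coe, RingHom.coe_coe] at key
      linear_combination - key
    have h2 := row_shift (X (i + 1)) i (fun L' => row (X i) (Finset.Ico i n)
      (insert i (Finset.Ico (i + 2) n)) L' fun L' => rows n i L' F) (Ico_succ_subset (i + 1) n) hL
    rw [e3, shift_of_notMem hb, e4] at h2
    rw [h1, twoRow, h2]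
    refine row_congr (Ico_succ_subset (i + 1) n) hL fun L' hL' => ?_
    have h3 := row_shift (X i) i (fun L' => rows n i L' F) (Ico_succ_subset i n) hL'
    rw [e3, shift_of_mem (by simp; omega)] at h3
    rw [h3]
    exact row_congr (Ico_succ_subset i n) hL' fun L'' hL'' => rows_shift le_rfl hi hL'' F
  | succ k hk ih =>
    rw [rows, piBeta_row (sPoly_X_of_ne (by omega) (by omega))]
    exact row_congr (Ico_succ_subset k n) hL fun L' hL' => ih hL'


/-! ### Key columns -/

/-- `C₀ ◁ (C₁ ◁ ⋯ ◁ (C_{l-1} ◁ S))`. -/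
def triFold (C : ℕ → Finset ℕ) : ℕ → Finset ℕ → Finset ℕ
  | 0, S => S
  | l + 1, S => triFold C l (tri (C l) S)

/-- Column `j` of the left key of the tableau with columns `C`. -/
def keyCol (C : ℕ → Finset ℕ) (j : ℕ) : Finset ℕ := triFold C j (C j)

/-- The first `N` columns of the left key. -/
def keyList (N : ℕ) (C : ℕ → Finset ℕ) : List (Finset ℕ) := (List.range N).map (keyCol C)

theorem triFold_eq_foldr (C : ℕ → Finset ℕ) (l : ℕ) (S : Finset ℕ) :
    triFold C l S = ((List.range l).map C).foldr tri S := by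
  induction l generalizing S with
  | zero => rfl
  | succ l ih => simp [triFold, ih, List.range_succ]

theorem triFold_mono (C : ℕ → Finset ℕ) (l : ℕ) {S T : Finset ℕ} (h : S ⊆ T) :
    triFold C l S ⊆ triFold C l T := by
  induction l generalizing S T with
  | zero => exact h
  | succ l ih => exact ih (tri_mono _ h)

theorem triFold_congr {C C' : ℕ → Finset ℕ} {l : ℕ} (h : ∀ i < l, C i = C' i) (S : Finset ℕ) :
    triFold C l S = triFold C' l S := by
  induction l generalizing S with
  | zero => rfl
  | succ l ih => rw [triFold, triFold, h l (Nat.lt_succ_self l), ih fun i hi => h i (by omega)]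

theorem keyCol_congr {C C' : ℕ → Finset ℕ} {j : ℕ} (h : ∀ i ≤ j, C i = C' i) :
    keyCol C j = keyCol C' j := by
  rw [keyCol, keyCol, h j le_rfl, triFold_congr fun i hi => h i hi.le]

/-- The columns `C` form a reverse semistandard tableau. -/
def Semistandard (C : ℕ → Finset ℕ) : Prop := ∀ j a, countGe (C (j + 1)) a ≤ countGe (C j) a

theorem Semistandard.countGe_le {C : ℕ → Finset ℕ} (hC : Semistandard C) {i j : ℕ} (h : i ≤ j)
    (a : ℕ) : countGe (C j) a ≤ countGe (C i) a := by
  induction j, h using Nat.le_induction with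
  | base => exact le_rfl
  | succ j _ ih => exact (hC j a).trans ih

theorem Semistandard.card_le {C : ℕ → Finset ℕ} (hC : Semistandard C) {i j : ℕ} (h : i ≤ j) :
    (C j).card ≤ (C i).card := by
  rw [← countGe_zero, ← countGe_zero]
  exact hC.countGe_le h 0

theorem Semistandard.triFold_count {C : ℕ → Finset ℕ} (hC : Semistandard C) {l : ℕ} {S : Finset ℕ}
    (hS : ∀ i < l, ∀ a, countGe S a ≤ countGe (C i) a) :
    (triFold C l S).card = S.card ∧ ∀ a, countGe S a ≤ countGe (triFold C l S) a := by
  induction l generalizing S with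
  | zero => exact ⟨rfl, fun _ => le_rfl⟩
  | succ l ih =>
    have h := hS l (Nat.lt_succ_self l)
    obtain ⟨h1, h2⟩ := ih (S := tri (C l) S) fun i hi a =>
      (countGe_mono (tri_subset _ _) a).trans (hC.countGe_le hi.le a)
    exact ⟨h1.trans (card_tri h), fun a => (countGe_le_tri h a).trans (h2 a)⟩

theorem Semistandard.card_keyCol {C : ℕ → Finset ℕ} (hC : Semistandard C) (j : ℕ) :
    (keyCol C j).card = (C j).card :=
  (hC.triFold_count fun _ hi a => hC.countGe_le hi.le a).1

theorem Semistandard.countGe_le_keyCol {C : ℕ → Finset ℕ} (hC : Semistandard C) (j a : ℕ) :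
    countGe (C j) a ≤ countGe (keyCol C j) a :=
  (hC.triFold_count fun _ hi a => hC.countGe_le hi.le a).2 a

theorem keyCol_succ_subset (C : ℕ → Finset ℕ) (j : ℕ) : keyCol C (j + 1) ⊆ keyCol C j :=
  triFold_mono C j (tri_subset _ _)

/-- `tri_addMin` is iterated. Dominance keeps all cardinalities, so exactly one letter is added at
every stage, as that lemma requires. -/
theorem Semistandard.triFold_addMin {C : ℕ → Finset ℕ} (hC : Semistandard C) {l : ℕ}
    {S T : Finset ℕ} (hST : S ⊆ T) (hT : ∀ i < l, ∀ a, countGe T a ≤ countGe (C i) a) :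
    triFold C l (addMin S T) = addMin (triFold C l S) (triFold C l T) := by
  by_cases hTS : T ⊆ S
  · rw [addMin_of_subset hTS, addMin_of_subset (triFold_mono C l hTS)]
  induction l generalizing S T with
  | zero => rfl
  | succ l ih =>
    have h := hT l (Nat.lt_succ_self l)
    obtain ⟨m, hmT, hmS, -, e⟩ := exists_addMin hTS
    have c1 : (tri (C l) (addMin S T)).card = (addMin S T).card :=
      card_tri fun a => (countGe_mono (addMin_subset hST) a).trans (h a)
    have c2 : (tri (C l) S).card = S.card := card_tri fun a => (countGe_mono hST a).trans (h a)
    have c3 : (tri (C l) T).card = T.card := card_tri h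
    have hlt : S.card < T.card := Finset.card_lt_card ⟨hST, hTS⟩
    rw [triFold, tri_addMin hST (by rw [c1, c2, e, Finset.card_insert_of_notMem hmS])]
    refine ih (tri_mono _ hST)
      (fun i hi a => (countGe_mono (tri_subset _ _) a).trans (hC.countGe_le hi.le a)) fun h => ?_
    have := Finset.card_le_card h
    omega

/-! ### Adding a new smallest letter to a tableau -/

/-- Add the letter `k` to the columns in `J`. -/
def addRow (k : ℕ) (J : Finset ℕ) (C : ℕ → Finset ℕ) (j : ℕ) : Finset ℕ :=
  if j ∈ J then insert k (C j) else C j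

theorem addRow_of_mem {k j : ℕ} {J : Finset ℕ} (C : ℕ → Finset ℕ) (h : j ∈ J) :
    addRow k J C j = insert k (C j) := if_pos h

theorem addRow_of_notMem {k j : ℕ} {J : Finset ℕ} (C : ℕ → Finset ℕ) (h : j ∉ J) :
    addRow k J C j = C j := if_neg h

theorem triFold_addRow {k : ℕ} {C : ℕ → Finset ℕ} (hk : ∀ j, ∀ x ∈ C j, k < x)
    (J : Finset ℕ) (l : ℕ) {S : Finset ℕ} (hS : ∀ x ∈ S, k < x) :
    triFold (addRow k J C) l S = triFold C l S := by
  induction l generalizing S with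
  | zero => rfl
  | succ l ih =>
    have h1 : tri (addRow k J C l) S = tri (C l) S := by
      unfold addRow
      split_ifs
      · exact tri_insert_left hS fun h => lt_irrefl _ (hk l k h)
      · rfl
    rw [triFold, triFold, h1, ih fun x hx => hk l x (tri_subset _ _ hx)]

theorem countGe_addRow {k : ℕ} {C : ℕ → Finset ℕ} (hk : ∀ j, ∀ x ∈ C j, k < x)
    (J : Finset ℕ) (j : ℕ) {a : ℕ} (ha : k < a) :
    countGe (addRow k J C j) a = countGe (C j) a := by
  unfold addRow
  split_ifs
  · rw [countGe_insert fun h => lt_irrefl _ (hk j k h), if_neg (by omega), add_zero]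
  · rfl

theorem countGe_addRow_of_le {k : ℕ} {C : ℕ → Finset ℕ} (hk : ∀ j, ∀ x ∈ C j, k < x)
    (J : Finset ℕ) (j : ℕ) {a : ℕ} (ha : a ≤ k) :
    countGe (addRow k J C j) a = (addRow k J C j).card := by
  rw [countGe, Finset.filter_true_of_mem]
  intro x hx
  unfold addRow at hx
  split_ifs at hx
  · rcases Finset.mem_insert.mp hx with rfl | hx
    · exact ha
    · have := hk j x hx
      omega
  · have := hk j x hx
    omega

theorem card_addRow {k : ℕ} {C : ℕ → Finset ℕ} (hk : ∀ j, ∀ x ∈ C j, k < x)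
    (J : Finset ℕ) (j : ℕ) :
    (addRow k J C j).card = (C j).card + if j ∈ J then 1 else 0 := by
  unfold addRow
  split_ifs
  · rw [Finset.card_insert_of_notMem fun h => lt_irrefl _ (hk j k h)]
  · rfl

theorem Semistandard.of_addRow {k : ℕ} {C : ℕ → Finset ℕ} (hk : ∀ j, ∀ x ∈ C j, k < x)
    {J : Finset ℕ} (hC : Semistandard (addRow k J C)) :
    Semistandard C := by
  intro j a
  rcases lt_or_ge k a with ha | ha
  · have := hC j a
    rwa [countGe_addRow hk J _ ha, countGe_addRow hk J _ ha] at this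
  · have h := hC j (k + 1)
    rw [countGe_addRow hk J _ (Nat.lt_succ_self k), countGe_addRow hk J _ (Nat.lt_succ_self k)] at h
    have e : ∀ j, countGe (C j) a = countGe (C j) (k + 1) := by
      intro j
      unfold countGe
      congr 1
      ext x
      have := hk j x
      simp only [Finset.mem_filter]
      constructor <;> rintro ⟨h1, h2⟩ <;> refine ⟨h1, ?_⟩ <;> have := this h1 <;> omega
    rwa [e, e]

/-- Counts above `k` do not change, and at thresholds up to `k` they are the column lengths, so only
the lengths matter. -/
theorem semistandard_addRow_iff {k : ℕ} {C : ℕ → Finset ℕ} (hk : ∀ j, ∀ x ∈ C j, k < x)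
    (hC : Semistandard C) (J : Finset ℕ) :
    Semistandard (addRow k J C) ↔
      ∀ j, j + 1 ∈ J → (C (j + 1)).card < (addRow k J C j).card := by
  constructor
  · intro h j hj
    have := h.card_le (Nat.le_succ j)
    rw [card_addRow hk J (j + 1), if_pos hj] at this
    omega
  · intro h j a
    rcases lt_or_ge k a with ha | ha
    · rw [countGe_addRow hk J _ ha, countGe_addRow hk J _ ha]
      exact hC j a
    · rw [countGe_addRow_of_le hk J _ ha, countGe_addRow_of_le hk J _ ha, card_addRow hk J (j + 1)]
      split_ifs with hj
      · exact h j hj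
      · have h1 : (C (j + 1)).card ≤ (C j).card := hC.card_le (Nat.le_succ j)
        rw [card_addRow hk]
        omega

theorem keyCol_addRow_zero {k : ℕ} {C : ℕ → Finset ℕ} (hk : ∀ j, ∀ x ∈ C j, k < x)
    {n : ℕ} {J : Finset ℕ} (hkn : k < n) :
    keyCol (addRow k J C) 0 = if 0 ∈ J then addMin (keyCol C 0) (Finset.Ico k n) else keyCol C 0 := by
  simp only [keyCol, triFold, addRow]
  split_ifs
  · refine (addMin_eq (by simp [hkn]) (fun h => lt_irrefl _ (hk 0 k h)) fun x hx _ => ?_).symm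
    exact (Finset.mem_Ico.mp hx).1
  · rfl

theorem keyCol_eq_triFold_addRow {k : ℕ} {C : ℕ → Finset ℕ} (hk : ∀ j, ∀ x ∈ C j, k < x)
    (J : Finset ℕ) (j : ℕ) :
    keyCol C j = triFold (addRow k J C) j (C j) := (triFold_addRow hk J j (hk j)).symm

theorem keyCol_subset_keyCol_addRow {k : ℕ} {C : ℕ → Finset ℕ} (hk : ∀ j, ∀ x ∈ C j, k < x)
    (J : Finset ℕ) (j : ℕ) :
    keyCol C (j + 1) ⊆ keyCol (addRow k J C) j := by
  rw [keyCol_eq_triFold_addRow hk J]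
  exact triFold_mono _ j (tri_subset _ _)

/-- By `tri_insert_right` the innermost `◁` gains the least free letter of the neighbouring column.
The remaining operations commute with `addMin`, and they send that neighbour to its own key column.
-/
theorem keyCol_addRow_succ {k : ℕ} {C : ℕ → Finset ℕ} (hk : ∀ j, ∀ x ∈ C j, k < x)
    {J : Finset ℕ} (hC : Semistandard (addRow k J C)) (j : ℕ) :
    keyCol (addRow k J C) (j + 1) = if j + 1 ∈ J then
      addMin (keyCol C (j + 1)) (keyCol (addRow k J C) j) else keyCol C (j + 1) := by
  split_ifs with hj
  · rw [keyCol, addRow_of_mem C hj, keyCol_eq_triFold_addRow hk J (j + 1), triFold, triFold]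
    have hkS : k ∉ C (j + 1) := fun h => lt_irrefl _ (hk _ _ h)
    have h1 : ∀ a, countGe (insert k (C (j + 1))) a ≤ countGe (addRow k J C j) a := fun a => by
      have := hC j a
      rwa [addRow_of_mem C hj] at this
    rw [tri_insert_right (hk (j + 1)) _ _, hC.triFold_addMin (tri_subset _ _)
      fun i hi a => hC.countGe_le hi.le a]
    · rfl
    · intro x hx
      unfold addRow at hx
      split_ifs at hx
      · rcases Finset.mem_insert.mp hx with rfl | hx
        · exact le_rfl
        · exact (hk j x hx).le
      · exact (hk j x hx).le
    · rw [card_tri h1, card_tri fun a => (countGe_mono (Finset.subset_insert _ _) a).trans (h1 a),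
        Finset.card_insert_of_notMem hkS]
  · rw [keyCol, addRow_of_notMem C hj, keyCol_eq_triFold_addRow hk J]


/-! ### Summing over columns -/

theorem addRow_congr {k i : ℕ} {J J' : Finset ℕ} (C : ℕ → Finset ℕ) (h : i ∈ J ↔ i ∈ J') :
    addRow k J C i = addRow k J' C i := by simp only [addRow, h]

/-- The factor contributed to the weight by the letter `k` in column `j`. -/
noncomputable def letterWt (C : ℕ → Finset ℕ) (k j : ℕ) : R :=
  if k ∈ C j then X k
  else if countGe (C (j + 1)) (k + 1) < countGe (C j) (k + 1) then 1 + beta * X k else 1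

theorem letterWt_addRow {k : ℕ} {C : ℕ → Finset ℕ} (hk : ∀ j, ∀ x ∈ C j, k < x) (J : Finset ℕ)
    (j : ℕ) : letterWt (addRow k J C) k j = if j ∈ J then X k else
      if (C (j + 1)).card < (C j).card then 1 + beta * X k else 1 := by
  have e : ∀ j, countGe (addRow k J C j) (k + 1) = (C j).card := by
    intro j
    rw [countGe_addRow hk J j (Nat.lt_succ_self k), countGe, Finset.filter_true_of_mem]
    exact hk j
  have h : k ∈ addRow k J C j ↔ j ∈ J := by
    unfold addRow
    split_ifs with h
    · simp [h]
    · simp only [h, iff_false]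
      exact fun h => lt_irrefl _ (hk j k h)
  simp only [letterWt, e, h]

theorem letterWt_addRow_of_lt {k l : ℕ} {C : ℕ → Finset ℕ} (hk : ∀ j, ∀ x ∈ C j, k < x)
    (J : Finset ℕ) (j : ℕ) (h : k < l) : letterWt (addRow k J C) l j = letterWt C l j := by
  have h' : l ∈ addRow k J C j ↔ l ∈ C j := by
    unfold addRow
    split_ifs
    · simp [h.ne']
    · rfl
  simp only [letterWt, h', countGe_addRow hk J _ (show k < l + 1 by omega)]

/-- The contribution of a tableau with columns `C` to the effect of a row for the letter `k`. -/
noncomputable def rowTerm (N k : ℕ) (F : List (Finset ℕ) → R) (C : ℕ → Finset ℕ) : R :=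
  open Classical in
  if Semistandard C then (∏ j ∈ Finset.range N, letterWt C k j) * F (keyList N C) else 0

theorem corner_eq_letterWt {k : ℕ} {C : ℕ → Finset ℕ} (hk : ∀ j, ∀ x ∈ C j, k < x)
    (hC : Semistandard C) {J : Finset ℕ} {j : ℕ} (hj : j ∉ J) :
    corner (X k) (keyCol C j) (keyCol C j) (keyCol C (j + 1)) = letterWt (addRow k J C) k j := by
  rw [letterWt_addRow hk, if_neg hj, corner]
  have h := keyCol_succ_subset C j
  have : keyCol C (j + 1) ≠ keyCol C j ↔ (C (j + 1)).card < (C j).card := by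
    rw [← hC.card_keyCol, ← hC.card_keyCol j]
    exact ⟨fun hne => Finset.card_lt_card (h.ssubset_of_ne hne), fun hlt he => by simp [he] at hlt⟩
  simp only [true_and, this]

-- The induction runs over the columns from `j` on. `J` records the columns before `j` that received
-- `k`; `B` and `B'` stand for the new and the old key column `j - 1`, a fictitious one if `j = 0`.
-- The factor of column `j - 1` involves column `j` too, hence it is still pending as `corner`, and
-- `q` times it is the weight of the columns before `j`.
set_option maxHeartbeats 1000000 in
theorem row_eq_sum_aux {N k : ℕ} {C : ℕ → Finset ℕ} (hk : ∀ j, ∀ x ∈ C j, k < x)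
    (hC : Semistandard C) (hN : ∀ j, N ≤ j → C j = ∅) (F : List (Finset ℕ) → R) (m : ℕ) :
    ∀ (j : ℕ) (J : Finset ℕ) (B B' : Finset ℕ) (q : R), j + m = N → J ⊆ Finset.range j →
      Semistandard (addRow k J C) → keyCol C j ⊆ B →
      (keyCol C j = B → 0 < j ∧ (C j).card = (addRow k J C (j - 1)).card) →
      (keyCol C j ≠ B → Semistandard (addRow k (insert j J) C) ∧
        keyCol (addRow k (insert j J) C) j = addMin (keyCol C j) B) →
      q * corner (X k) B B' (keyCol C j) =
        ∏ i ∈ Finset.range j, letterWt (addRow k J C) k i →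
      q * row (X k) B B' ((List.range' j m).map (keyCol C))
          (fun L => F ((List.range j).map (keyCol (addRow k J C)) ++ L))
        = ∑ J' ∈ (Finset.Ico j N).powerset, rowTerm N k F (addRow k (J ∪ J') C) := by
  induction m with
  | zero =>
    intro j J B B' q hj hJ hJC hB _ _ hq
    obtain rfl : j = N := by omega
    have e : keyCol C j = ∅ := by
      rw [← Finset.card_eq_zero, hC.card_keyCol, hN j le_rfl, Finset.card_empty]
    rw [e] at hq
    simp [row, rowTerm, keyList, hJC, ← mul_assoc, hq]
  | succ m ih =>
    intro j J B B' q hj hJ hJC hB hB0 hB1 hq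
    have hjJ : j ∉ J := fun h => by simpa using hJ h
    have hlt : j < N := by omega
    have hins : Finset.Ico j N = insert j (Finset.Ico (j + 1) N) := by
      ext x
      simp only [Finset.mem_insert, Finset.mem_Ico]
      omega
    have hnot : j ∉ Finset.Ico (j + 1) N := by simp
    have hkJ : keyCol C j = keyCol (addRow k J C) j := by
      cases j with
      | zero => rw [keyCol, keyCol, addRow_of_notMem C hjJ]; rfl
      | succ j => rw [keyCol_addRow_succ hk hJC, if_neg hjJ]
    have hJ1 : J ⊆ Finset.range (j + 1) := hJ.trans (Finset.range_subset_range.mpr (Nat.le_succ j))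
    have hJ2 : insert j J ⊆ Finset.range (j + 1) :=
      Finset.insert_subset (by simp) hJ1
    have hstep : ∀ J₂ : Finset ℕ, J₂ ⊆ Finset.range (j + 1) → Semistandard (addRow k J₂ C) →
        (keyCol C (j + 1) = keyCol (addRow k J₂ C) j →
          0 < j + 1 ∧ (C (j + 1)).card = (addRow k J₂ C (j + 1 - 1)).card) ∧
        (keyCol C (j + 1) ≠ keyCol (addRow k J₂ C) j →
          Semistandard (addRow k (insert (j + 1) J₂) C) ∧
          keyCol (addRow k (insert (j + 1) J₂) C) (j + 1)
            = addMin (keyCol C (j + 1)) (keyCol (addRow k J₂ C) j)) := by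
      intro J₂ hJ₂ hS
      have hsub := keyCol_subset_keyCol_addRow hk J₂ j
      have hprev : ∀ i ≤ j, addRow k (insert (j + 1) J₂) C i = addRow k J₂ C i := fun i hi =>
        addRow_congr C (by simp; omega)
      refine ⟨fun he => ⟨Nat.succ_pos j, ?_⟩, fun hne => ?_⟩
      · rw [Nat.add_sub_cancel, ← hS.card_keyCol, ← hC.card_keyCol, he]
      · have hcard : (C (j + 1)).card < (addRow k J₂ C j).card := by
          rw [← hS.card_keyCol, ← hC.card_keyCol]
          exact Finset.card_lt_card (hsub.ssubset_of_ne hne)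
        have hS' : Semistandard (addRow k (insert (j + 1) J₂) C) := by
          rw [semistandard_addRow_iff hk hC] at hS ⊢
          intro i hi
          rcases Finset.mem_insert.mp hi with hi | hi
          · obtain rfl : i = j := by omega
            rwa [hprev i le_rfl]
          · have := Finset.mem_range.mp (hJ₂ hi)
            rw [hprev i (by omega)]
            exact hS i hi
        refine ⟨hS', ?_⟩
        rw [keyCol_addRow_succ hk hS', if_pos (Finset.mem_insert_self _ _), keyCol_congr hprev]
    have hkeys : ∀ J₂ : Finset ℕ, (∀ i < j, i ∈ J₂ ↔ i ∈ J) →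
        (List.range (j + 1)).map (keyCol (addRow k J₂ C))
          = (List.range j).map (keyCol (addRow k J C)) ++ [keyCol (addRow k J₂ C) j] := by
      intro J₂ h
      rw [List.range_succ, List.map_append, List.map_singleton]
      congr 1
      refine List.map_congr_left fun i hi => keyCol_congr fun i' hi' => addRow_congr C (h i' ?_)
      have := List.mem_range.mp hi
      omega
    have hwt : ∀ J₂ : Finset ℕ, (∀ i < j, i ∈ J₂ ↔ i ∈ J) →
        ∏ i ∈ Finset.range j, letterWt (addRow k J₂ C) k i
          = ∏ i ∈ Finset.range j, letterWt (addRow k J C) k i := by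
      intro J₂ h
      refine Finset.prod_congr rfl fun i hi => ?_
      rw [letterWt_addRow hk, letterWt_addRow hk]
      simp only [h i (Finset.mem_range.mp hi)]
    rw [hins, Finset.sum_powerset_insert hnot, List.range'_succ, List.map_cons, row, ← mul_assoc,
      hq, mul_add]
    have hne0 : keyCol C (j + 1) ⊆ keyCol C j := keyCol_succ_subset C j
    congr 1
    · have h1 := hstep J hJ1 hJC
      rw [← hkJ] at h1
      have := ih (j + 1) J (keyCol C j) (keyCol C j)
        (∏ i ∈ Finset.range j, letterWt (addRow k J C) k i) (by omega) hJ1 hJC hne0 h1.1 h1.2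
        (by rw [corner_eq_letterWt hk hC hjJ, Finset.prod_range_succ])
      rw [← this]
      congr 2
      funext L
      rw [hkeys J fun _ _ => Iff.rfl, ← hkJ, List.append_assoc, List.singleton_append]
    -- If the key columns agree, column `j` is already as long as the new column `j - 1`, so the
    -- tableaux with `k` in column `j` are not semistandard.
    · by_cases hAB : keyCol C j = B
      · rw [if_pos hAB, mul_zero]
        refine (Finset.sum_eq_zero fun J' hJ' => ?_).symm
        rw [rowTerm, if_neg]
        intro hS
        obtain ⟨hj0, hcard⟩ := hB0 hAB
        obtain ⟨i, rfl⟩ : ∃ i, j = i + 1 := ⟨j - 1, by omega⟩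
        have := (semistandard_addRow_iff hk hC _).mp hS i (by simp)
        have hi := Finset.mem_powerset.mp hJ'
        have hi : i ∉ J' := fun h => by simpa using hi h
        have e : addRow k (J ∪ insert (i + 1) J') C i = addRow k J C i :=
          addRow_congr C (by simp [hi])
        rw [hcard, Nat.add_sub_cancel, e] at this
        exact lt_irrefl _ this
      · obtain ⟨hS, hkey⟩ := hB1 hAB
        have hmem : ∀ i < j, i ∈ insert j J ↔ i ∈ J := fun i hi => by simp; omega
        have h1 := hstep (insert j J) hJ2 hS
        rw [hkey] at h1
        have hne : addMin (keyCol C j) B ≠ keyCol C j := fun he => by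
          have h1 := hS.card_keyCol j
          rw [hkey, he, hC.card_keyCol, card_addRow hk, if_pos (Finset.mem_insert_self _ _)] at h1
          omega
        have := ih (j + 1) (insert j J) (addMin (keyCol C j) B) (keyCol C j)
          ((∏ i ∈ Finset.range j, letterWt (addRow k J C) k i) * X k) (by omega) hJ2 hS
          (hne0.trans (subset_addMin _ _)) h1.1 h1.2
          (by
            rw [corner, if_neg fun h => hne h.1, mul_one, Finset.prod_range_succ, hwt _ hmem,
              letterWt_addRow hk, if_pos (Finset.mem_insert_self _ _)])
        rw [if_neg hAB, ← mul_assoc]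
        refine Eq.trans ?_ (this.trans (Finset.sum_congr rfl fun J' _ => ?_))
        · congr 2
          funext L
          rw [hkeys _ hmem, hkey, List.append_assoc, List.singleton_append]
        · rw [Finset.insert_union, Finset.union_insert]

theorem row_eq_sum {N n k : ℕ} {C : ℕ → Finset ℕ} (hk : ∀ j, ∀ x ∈ C j, k < x)
    (hn : ∀ j, ∀ x ∈ C j, x < n) (hkn : k < n)
    (hC : Semistandard C) (hN : ∀ j, N ≤ j → C j = ∅) (F : List (Finset ℕ) → R) :
    row (X k) (Finset.Ico k n) (Finset.Ico (k + 1) n) (keyList N C) F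
      = ∑ J ∈ (Finset.range N).powerset, rowTerm N k F (addRow k J C) := by
  have h0 : k ∉ keyCol C 0 := fun h => lt_irrefl _ (hk 0 k h)
  have hne : Finset.Ico k n ≠ Finset.Ico (k + 1) n := fun h => by
    have : k ∈ Finset.Ico (k + 1) n := h ▸ by simp [hkn]
    simp at this
  -- The fictitious column `[k, n)` on the left always permits a new letter in column `0`, and makes
  -- that letter `k` itself. It grows from `[k + 1, n)`, so its corner factor is `1`.
  have := row_eq_sum_aux hk hC hN F N 0 ∅ (Finset.Ico k n) (Finset.Ico (k + 1) n) 1 (zero_add N)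
    (Finset.empty_subset _) ?_ ?_ ?_ ?_ ?_
  · simpa [keyList, List.range_eq_range'] using this
  · rw [semistandard_addRow_iff hk hC]
    simp
  · intro x hx
    rw [Finset.mem_Ico]
    exact ⟨(hk 0 x hx).le, hn 0 x hx⟩
  · intro h
    exact absurd (h ▸ by simp [hkn]) h0
  · intro _
    refine ⟨?_, ?_⟩
    · rw [semistandard_addRow_iff hk hC]
      simp
    · rw [keyCol_addRow_zero hk hkn, if_pos (by simp)]
  · rw [corner, if_neg fun h => hne h.1]
    simp

/-! ### All letters together -/

/-- The columns encoded by a set of pairs (letter, column). -/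
def cols (M : Finset (ℕ × ℕ)) (j : ℕ) : Finset ℕ := (M.filter (·.2 = j)).image Prod.fst

theorem mem_cols {M : Finset (ℕ × ℕ)} {l j : ℕ} : l ∈ cols M j ↔ (l, j) ∈ M := by
  simp [cols]

/-- The contribution of the tableau with columns `cols M`. -/
noncomputable def tabTerm (n N k : ℕ) (F : List (Finset ℕ) → R) (C : ℕ → Finset ℕ) : R :=
  open Classical in
  if Semistandard C then
    (∏ l ∈ Finset.Ico k n, ∏ j ∈ Finset.range N, letterWt C l j) * F (keyList N C) else 0

theorem sum_tabTerm_succ {n N k : ℕ} (hkn : k < n) (F : List (Finset ℕ) → R) :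
    ∑ M ∈ (Finset.Ico k n ×ˢ Finset.range N).powerset, tabTerm n N k F (cols M)
      = ∑ M ∈ (Finset.Ico (k + 1) n ×ˢ Finset.range N).powerset, tabTerm n N (k + 1)
        (fun L => row (X k) (Finset.Ico k n) (Finset.Ico (k + 1) n) L F) (cols M) := by
  have hb : ∀ M ∈ (Finset.Ico (k + 1) n ×ˢ Finset.range N).powerset, ∀ l j, l ∈ cols M j →
      k < l ∧ l < n ∧ j < N := by
    intro M hM l j h
    have := Finset.mem_powerset.mp hM (mem_cols.mp h)
    simp only [Finset.mem_product, Finset.mem_Ico, Finset.mem_range] at this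
    omega
  have hcols : ∀ (M : Finset (ℕ × ℕ)) (J : Finset ℕ),
      cols (M ∪ J.image (k, ·)) = addRow k J (cols M) := by
    intro M J
    funext j
    ext l
    unfold addRow
    split_ifs with h <;> simp [mem_cols, h, eq_comm, or_comm]
  -- A set of pairs splits uniquely into its pairs with letter above `k` and the set of columns that
  -- contain `k`.
  trans ∑ p ∈ (Finset.Ico (k + 1) n ×ˢ Finset.range N).powerset ×ˢ (Finset.range N).powerset,
      tabTerm n N k F (addRow k p.2 (cols p.1))
  · refine (Finset.sum_nbij' (fun p => p.1 ∪ p.2.image (k, ·))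
      (fun M => (M.filter (·.1 ≠ k), (Finset.range N).filter fun j => (k, j) ∈ M))
      ?_ ?_ ?_ ?_ ?_).symm
    · rintro ⟨M, J⟩ h
      simp only [Finset.mem_product, Finset.mem_powerset] at h ⊢
      refine Finset.union_subset (h.1.trans (Finset.product_subset_product_left
        (Ico_succ_subset k n))) fun x hx => ?_
      obtain ⟨j, hj, rfl⟩ := Finset.mem_image.mp hx
      have := h.2 hj
      simp_all
    · intro M h
      simp only [Finset.mem_product, Finset.mem_powerset] at h ⊢
      refine ⟨fun x hx => ?_, Finset.filter_subset _ _⟩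
      rw [Finset.mem_filter] at hx
      have := h hx.1
      simp only [Finset.mem_product, Finset.mem_Ico, Finset.mem_range] at this ⊢
      omega
    · rintro ⟨M, J⟩ h
      simp only [Finset.mem_product, Finset.mem_powerset] at h
      have h1 : ∀ j, (k, j) ∉ M := fun j hj => by simpa using h.1 hj
      have h2 : ∀ x ∈ M, x.1 ≠ k := fun x hx he => h1 x.2 (he ▸ hx)
      have h3 : ∀ j ∈ J, j < N := fun j hj => by simpa using h.2 hj
      simp only [Prod.mk.injEq]
      constructor
      · ext x
        simp only [Finset.mem_filter, Finset.mem_union, Finset.mem_image]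
        have := h2 x
        grind
      · ext x
        simp only [Finset.mem_filter, Finset.mem_union, Finset.mem_image, Finset.mem_range]
        have := h1 x
        have := h3 x
        grind
    · intro M h
      rw [Finset.mem_powerset] at h
      ext ⟨l, j⟩
      have := @h (l, j)
      simp only [Finset.mem_product, Finset.mem_Ico, Finset.mem_range] at this
      simp only [Finset.mem_filter, Finset.mem_union, Finset.mem_image, Finset.mem_range]
      grind
    · rintro ⟨M, J⟩ h
      rw [hcols]
  · rw [Finset.sum_product]
    refine Finset.sum_congr rfl fun M hM => ?_
    have hk : ∀ j, ∀ x ∈ cols M j, k < x := fun j x hx => (hb M hM x j hx).1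
    have hn : ∀ j, ∀ x ∈ cols M j, x < n := fun j x hx => (hb M hM x j hx).2.1
    have hN : ∀ j, N ≤ j → cols M j = ∅ := fun j hj =>
      Finset.eq_empty_of_forall_notMem fun x hx => by
        have := (hb M hM x j hx).2.2
        omega
    by_cases hC : Semistandard (cols M)
    · rw [tabTerm, if_pos hC, row_eq_sum hk hn hkn hC hN, Finset.mul_sum]
      refine Finset.sum_congr rfl fun J _ => ?_
      unfold tabTerm rowTerm
      split_ifs
      · rw [← Finset.insert_Ico_add_one_left_eq_Ico hkn, Finset.prod_insert (by simp)]
        have : ∀ l ∈ Finset.Ico (k + 1) n, ∏ j ∈ Finset.range N, letterWt (addRow k J (cols M)) l j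
            = ∏ j ∈ Finset.range N, letterWt (cols M) l j := fun l hl =>
          Finset.prod_congr rfl fun j _ =>
            letterWt_addRow_of_lt hk J j (Finset.mem_Ico.mp hl).1
        rw [Finset.prod_congr rfl this]
        ring
      · rw [mul_zero]
    · rw [tabTerm, if_neg hC]
      refine Finset.sum_eq_zero fun J _ => ?_
      rw [tabTerm, if_neg fun h => hC (h.of_addRow hk)]

/-- The rows applied to the empty tableau give the sum over all tableaux. -/
theorem rows_eq_sum (n N : ℕ) (F : List (Finset ℕ) → R) :
    rows n n (List.replicate N ∅) F
      = ∑ M ∈ (Finset.range n ×ˢ Finset.range N).powerset, tabTerm n N 0 F (cols M) := by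
  have key : ∀ d k, k + d = n → rows n n (List.replicate N ∅) F
      = ∑ M ∈ (Finset.Ico k n ×ˢ Finset.range N).powerset,
        tabTerm n N k (fun L => rows n k L F) (cols M) := by
    intro d
    induction d with
    | zero =>
      rintro k rfl
      have h1 : cols ∅ = fun _ => ∅ := by
        funext j
        simp [cols]
      have h2 : Semistandard fun _ => ∅ := fun _ _ => le_rfl
      have h3 : keyList N (fun _ => ∅) = List.replicate N ∅ := by
        refine List.eq_replicate_iff.mpr ⟨by simp [keyList], fun b hb => ?_⟩
        obtain ⟨j, -, rfl⟩ := List.mem_map.mp hb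
        rw [← Finset.card_eq_zero, h2.card_keyCol, Finset.card_empty]
      simp [tabTerm, h1, h2, h3]
    | succ d ih =>
      intro k hk
      rw [ih (k + 1) (by omega), sum_tabTerm_succ (k := k) (by omega)]
      rfl
  have := key n 0 (zero_add n)
  rwa [← Finset.range_eq_Ico] at this


/-! ### The recursion for the generating function -/

/-- The composition whose part `i` is the number of sets in `L` that contain `i`. -/
noncomputable def compOf (L : List (Finset ℕ)) : Comp :=
  (L.map fun K => ∑ i ∈ K, Finsupp.single i 1).sum

theorem compOf_nil : compOf [] = 0 := rfl

theorem sum_single_apply (K : Finset ℕ) (c : ℕ) :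
    (∑ i ∈ K, Finsupp.single i 1 : Comp) c = if c ∈ K then 1 else 0 := by
  rw [Finsupp.finsetSum_apply]
  simp [Finsupp.single_apply]

theorem compOf_cons (K : Finset ℕ) (L : List (Finset ℕ)) (c : ℕ) :
    compOf (K :: L) c = (if c ∈ K then 1 else 0) + compOf L c := by
  rw [compOf, List.map_cons, List.sum_cons, Finsupp.add_apply, sum_single_apply]
  rfl

theorem compOf_append (L L' : List (Finset ℕ)) : compOf (L ++ L') = compOf L + compOf L' := by
  simp [compOf]

theorem compOf_eq_zero {L : List (Finset ℕ)} {c : ℕ} (h : ∀ K ∈ L, c ∉ K) : compOf L c = 0 := by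
  induction L with
  | nil => rfl
  | cons K L ih => rw [compOf_cons, if_neg (h K (by simp)), ih fun K hK => h K (by simp [hK])]

/-- In a chain, all sets that contain exactly one of `i` and `i + 1` contain the same one, and it is
the one with the larger count. -/
theorem compOf_map_shift (i : ℕ) {L : List (Finset ℕ)} (hL : L.Pairwise (· ⊇ ·)) :
    compOf (L.map (shift i)) = sortDesc i (compOf L) := by
  ext c
  rw [sortDesc_apply]
  induction L generalizing c with
  | nil => simp [compOf_nil]
  | cons K L ih =>
    rw [List.pairwise_cons] at hL
    have h0 : ∀ c ∉ K, compOf L c = 0 := fun c hc => compOf_eq_zero fun K' hK' h =>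
      hc (hL.1 K' hK' h)
    have h1 := h0 i
    have h2 := h0 (i + 1)
    rw [List.map_cons, compOf_cons, compOf_cons, compOf_cons, compOf_cons, ih hL.2 c]
    simp only [mem_shift]
    by_cases hc : c = i
    · subst hc
      by_cases a1 : c ∈ K <;> by_cases a2 : c + 1 ∈ K <;> simp_all
    · by_cases hc' : c = i + 1
      · subst hc'
        by_cases a1 : i ∈ K <;> by_cases a2 : i + 1 ∈ K <;> simp_all
      · simp [hc, hc']

theorem compOf_keyList_succ (N : ℕ) (C : ℕ → Finset ℕ) (c : ℕ) :
    compOf (keyList (N + 1) C) c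
      = compOf (keyList N C) c + if c ∈ keyCol C N then 1 else 0 := by
  rw [keyList, List.range_succ, List.map_append, compOf_append, List.map_singleton,
    Finsupp.add_apply, compOf_cons, compOf_nil]
  rfl

theorem keyCol_antitone (C : ℕ → Finset ℕ) : Antitone (keyCol C) :=
  antitone_nat_of_succ_le (keyCol_succ_subset C)

theorem compOf_keyList_le (N : ℕ) (C : ℕ → Finset ℕ) (c : ℕ) : compOf (keyList N C) c ≤ N := by
  induction N with
  | zero => simp [keyList, compOf_nil]
  | succ N ih =>
    rw [compOf_keyList_succ]
    split_ifs <;> omega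

/-- The key columns decrease, so those containing `c` form an initial segment. Thus the key
composition determines all key columns. -/
theorem mem_keyCol_iff {N j : ℕ} (C : ℕ → Finset ℕ) (hj : j < N) (c : ℕ) :
    c ∈ keyCol C j ↔ j < compOf (keyList N C) c := by
  induction N with
  | zero => omega
  | succ N ih =>
    rw [compOf_keyList_succ]
    have hle := compOf_keyList_le N C c
    rcases Nat.lt_succ_iff_lt_or_eq.mp hj with h | rfl
    · rw [ih h]
      split_ifs with hc
      · have h1 := (ih h).mp (keyCol_antitone C h.le hc)
        omega
      · omega
    · split_ifs with hc
      · simp only [hc, true_iff]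
        rcases Nat.eq_zero_or_pos j with rfl | hj0
        · omega
        · have : ∀ m ≤ j, compOf (keyList m C) c = m := by
            intro m hm
            induction m with
            | zero => simp [keyList, compOf_nil]
            | succ m ihm =>
              rw [compOf_keyList_succ, ihm (by omega), if_pos (keyCol_antitone C (by omega) hc)]
          rw [this j le_rfl]
          omega
      · simp only [hc, false_iff]
        omega

theorem pairwise_keyList (N : ℕ) (C : ℕ → Finset ℕ) : (keyList N C).Pairwise (· ⊇ ·) := by
  rw [keyList, List.pairwise_map]
  exact List.pairwise_lt_range.imp fun h => keyCol_antitone C h.le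

theorem sum_tabTerm_congr {n N k : ℕ} {s : Finset (Finset (ℕ × ℕ))} {F G : List (Finset ℕ) → R}
    (h : ∀ M, F (keyList N (cols M)) = G (keyList N (cols M))) :
    ∑ M ∈ s, tabTerm n N k F (cols M) = ∑ M ∈ s, tabTerm n N k G (cols M) := by
  simp only [tabTerm, h]

/-! ### Initial value at partitions and the recursion -/

/-- The indicator function of the lists of key columns that represent a key below `α`. -/
noncomputable def keyLE (α : Comp) (L : List (Finset ℕ)) : R :=
  open Classical in if CompLE (compOf L) α then 1 else 0

theorem sPoly_keyLE (i : ℕ) (α : Comp) (L : List (Finset ℕ)) :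
    sPoly i (keyLE α L) = keyLE α L := by
  unfold keyLE
  split_ifs <;> simp

theorem tri_of_subset {C S : Finset ℕ} (h : S ⊆ C) : tri C S = S := by
  refine (Finset.eq_of_subset_of_card_le (fun c hc => mem_tri.mpr ⟨h hc, c, le_rfl, ?_⟩) ?_).symm
  · exact (Finset.card_le_one.mpr fun a ha b hb => by
      simp only [Finset.mem_inter, Finset.mem_Icc] at ha hb
      omega).trans (countIcc_pos hc le_rfl le_rfl)
  · exact (card_tri fun a => countGe_mono h a).le

theorem keyCol_of_antitone {C : ℕ → Finset ℕ} (h : Antitone C) (j : ℕ) : keyCol C j = C j := by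
  have : ∀ l S, (∀ i < l, S ⊆ C i) → triFold C l S = S := by
    intro l
    induction l with
    | zero => exact fun _ _ => rfl
    | succ l ih =>
      intro S hS
      rw [triFold, tri_of_subset (hS l (Nat.lt_succ_self l)), ih S fun i hi => hS i (by omega)]
  exact this j _ fun i hi => h hi.le

theorem sum_tabTerm_of_isPartition {α : Comp} {n N : ℕ} (hα : IsPartition α)
    (hn : ∀ k, n ≤ k → α k = 0) (hN : ∀ k, α k ≤ N) :
    ∑ M ∈ (Finset.range n ×ˢ Finset.range N).powerset, tabTerm n N 0 (keyLE α) (cols M)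
      = monomial α 1 := by
  -- Column `j` of this tableau is the initial segment of all `l` with `j < α l`; it is its own left
  -- key.
  set M₀ := (Finset.range n ×ˢ Finset.range N).filter fun p => p.2 < α p.1 with hM₀
  have hmem : ∀ l j, l ∈ cols M₀ j ↔ j < α l := by
    intro l j
    rw [mem_cols, hM₀, Finset.mem_filter, Finset.mem_product, Finset.mem_range, Finset.mem_range]
    refine ⟨fun h => h.2, fun h => ⟨⟨?_, ?_⟩, h⟩⟩
    · by_contra hc
      have := hn l (not_lt.mp hc)
      omega
    · exact lt_of_lt_of_le h (hN l)
  have hanti : Antitone (cols M₀) := fun i j hij l hl => by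
    rw [hmem] at hl ⊢
    omega
  have hss : Semistandard (cols M₀) := fun j a => countGe_mono (hanti (Nat.le_succ j)) a
  have hkey : compOf (keyList N (cols M₀)) = α := by
    ext c
    have hle := compOf_keyList_le N (cols M₀) c
    have h : ∀ j < N, j < compOf (keyList N (cols M₀)) c ↔ j < α c := fun j hj => by
      rw [← mem_keyCol_iff _ hj, keyCol_of_antitone hanti, hmem]
    have h1 := hN c
    by_contra hne
    rcases lt_or_gt_of_ne hne with hlt | hlt
    · have := h _ (hlt.trans_le h1)
      omega
    · have := h _ (hlt.trans_le hle)
      omega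
  rw [Finset.sum_eq_single M₀]
  · rw [tabTerm, if_pos hss, keyLE, hkey, if_pos ((compLE_isPartition hα).mpr rfl), mul_one,
      ← Finset.range_eq_Ico]
    -- A letter missing from an initial segment has no entry above it there, so no factor `1 + β x`
    -- occurs.
    have hw : ∀ l j, letterWt (cols M₀) l j = if j < α l then X l else 1 := by
      intro l j
      rw [letterWt]
      simp only [hmem]
      split_ifs with h1 h2
      · rfl
      · have : countGe (cols M₀ j) (l + 1) = 0 := by
          rw [countGe, Finset.card_eq_zero, Finset.filter_eq_empty_iff]
          intro x hx hlx
          rw [hmem] at hx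
          have := hα (show l ≤ x by omega)
          omega
        omega
      · rfl
    have hp : ∀ l, ∏ j ∈ Finset.range N, letterWt (cols M₀) l j = X l ^ α l := by
      intro l
      simp only [hw]
      rw [Finset.prod_ite, Finset.prod_const_one, mul_one, Finset.prod_const]
      congr 1
      have : (Finset.range N).filter (· < α l) = Finset.range (α l) := by
        ext j
        have := hN l
        simp only [Finset.mem_filter, Finset.mem_range]
        omega
      rw [this, Finset.card_range]
    rw [Finset.prod_congr rfl fun l _ => hp l, monomial_eq, map_one, one_mul,
      Finsupp.prod_of_support_subset _ (s := Finset.range n) _ _ (by simp)]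
    intro k hk
    by_contra hc
    exact Finsupp.mem_support_iff.mp hk (hn k (by simpa using hc))
  · intro M hM hne
    rw [tabTerm]
    split_ifs with hS
    swap
    · rfl
    rw [keyLE, if_neg, mul_zero]
    rw [compLE_isPartition hα]
    intro he
    refine hne ?_
    have hsub : ∀ l j, (l, j) ∈ M → l < n ∧ j < N := by
      intro l j h
      simpa using Finset.mem_powerset.mp hM h
    have hK : ∀ j < N, ∀ c, c ∈ keyCol (cols M) j ↔ j < α c := fun j hj c => by
      rw [mem_keyCol_iff _ hj, he]
    -- The key column dominates the column and has the same size. As it is an initial segment, the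
    -- smallest set of its size, they coincide.
    have hC : ∀ j < N, cols M j = keyCol (cols M) j := by
      intro j hj
      refine Finset.eq_of_subset_of_card_le (fun x hx => ?_) (hS.card_keyCol j).le
      by_contra hxK
      have h1 := hS.countGe_le_keyCol j x
      have h2 : 0 < countGe (cols M j) x := Finset.card_pos.mpr ⟨x, by simp [hx]⟩
      have h3 : countGe (keyCol (cols M) j) x = 0 := by
        rw [countGe, Finset.card_eq_zero, Finset.filter_eq_empty_iff]
        intro y hy hxy
        rw [hK j hj] at hy hxK
        have := hα hxy
        omega
      omega
    ext ⟨l, j⟩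
    rw [← mem_cols, ← mem_cols (M := M₀), hmem]
    by_cases hj : j < N
    · rw [hC j hj, hK j hj]
    · rw [mem_cols]
      have := hN l
      exact ⟨fun h => absurd (hsub l j h).2 hj, fun h => by omega⟩
  · intro h
    exact absurd (Finset.mem_powerset.mpr (Finset.filter_subset _ _)) h

/-- The Lascoux polynomial as a sum over semistandard columns. -/
theorem lascoux_eq_sum {n N : ℕ} (α : Comp) (hn : ∀ k, n ≤ k → α k = 0) (hN : ∀ k, α k ≤ N) :
    lascoux α = ∑ M ∈ (Finset.range n ×ˢ Finset.range N).powerset,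
      tabTerm n N 0 (keyLE α) (cols M) := by
  induction h : moment α using Nat.strong_induction_on generalizing α with
  | _ m ih =>
    by_cases hp : ∃ i, α i < α (i + 1)
    · obtain ⟨i, hi⟩ := hp
      have hin : i + 1 < n := by
        by_contra hc
        have := hn (i + 1) (by omega)
        omega
      have hn' : ∀ k, n ≤ k → sComp i α k = 0 := fun k hk => by
        rw [sComp_of_ne α (by omega) (by omega), hn k hk]
      have hN' : ∀ k, sComp i α k ≤ N := fun k => by
        rw [sComp_apply]
        exact hN _
      have hchain : ChainIn (Finset.Ico n n) (List.replicate N ∅) := by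
        rw [ChainIn, List.isChain_iff_pairwise, List.pairwise_cons]
        refine ⟨fun b hb => ?_, List.pairwise_replicate.mpr (.inr (Finset.Subset.refl _))⟩
        rw [List.eq_of_mem_replicate hb]
        exact Finset.empty_subset _
      -- The sum for `s_i α` becomes a product of rows, `π_i` inserts `shift i` before the indicator
      -- function, and the rows are expanded again.
      rw [lascoux_of_ascent hi, ih _ (h ▸ moment_sComp_lt hi) _ hn' hN' rfl, ← rows_eq_sum,
        piBeta_rows hin hin hchain (sPoly_keyLE i _), rows_eq_sum]
      refine sum_tabTerm_congr fun M => ?_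
      rw [keyLE, keyLE, compOf_map_shift i (pairwise_keyList N _)]
      by_cases hc : CompLE (compOf (keyList N (cols M))) α
      · rw [if_pos hc, if_pos ((compLE_iff_sortDesc hi _).mp hc)]
      · rw [if_neg hc, if_neg fun h => hc ((compLE_iff_sortDesc hi _).mpr h)]
    · push Not at hp
      have hα : IsPartition α := antitone_nat_of_succ_le hp
      rw [lascoux_of_isPartition hα, sum_tabTerm_of_isPartition hα hn hN]


/-! ### Semistandard tableaux and their columns -/

theorem mem_iff_lt_card_of_isLowerSet {A : Finset ℕ} (h : ∀ i ∈ A, ∀ j < i, j ∈ A) (i : ℕ) :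
    i ∈ A ↔ i < A.card := by
  constructor
  · intro hi
    have : Finset.range (i + 1) ⊆ A := fun j hj => by
      rcases Nat.lt_succ_iff_lt_or_eq.mp (Finset.mem_range.mp hj) with hj | rfl
      · exact h i hi j hj
      · exact hi
    simpa using Finset.card_le_card this
  · intro hi
    by_contra hc
    have : A ⊆ Finset.range i := fun j hj => by
      rw [Finset.mem_range]
      by_contra hji
      rcases (not_lt.mp hji).lt_or_eq with hji | rfl
      · exact hc (h j hj i hji)
      · exact hc hj
    have := Finset.card_le_card this
    rw [Finset.card_range] at this
    omega

theorem countGe_succ (C : Finset ℕ) (k : ℕ) :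
    countGe C k = countGe C (k + 1) + if k ∈ C then 1 else 0 := by
  have : C.filter (k ≤ ·) = C.filter (k + 1 ≤ ·) ∪ C.filter (k = ·) := by
    ext x
    simp only [Finset.mem_filter, Finset.mem_union]
    grind
  rw [countGe, countGe, this, Finset.card_union_of_disjoint, Finset.filter_eq]
  · split_ifs <;> simp
  · rw [Finset.disjoint_left]
    intro x
    simp only [Finset.mem_filter]
    omega

theorem countGe_antitone (C : Finset ℕ) : Antitone (countGe C) := fun a b hab =>
  Finset.card_le_card fun x => by
    simp only [Finset.mem_filter]
    exact fun h => ⟨h.1, hab.trans h.2⟩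

theorem countGe_le_card (C : Finset ℕ) (a : ℕ) : countGe C a ≤ C.card :=
  Finset.card_le_card (Finset.filter_subset _ _)

namespace RSSYT

variable {μ : YoungDiagram}

theorem entry_lt (S : RSSYT μ) {i i' j : ℕ} (h : i < i') (h' : (i', j) ∈ μ) :
    S.entry i' j < S.entry i j := by
  induction i', h using Nat.le_induction with
  | base => exact S.col_strict i j h'
  | succ i' _ ih =>
    exact (S.col_strict i' j h').trans (ih (μ.up_left_mem (Nat.le_succ i') le_rfl h'))

theorem entry_injOn (S : RSSYT μ) (j : ℕ) :
    Set.InjOn (fun i => S.entry i j) (Finset.range (μ.colLen j)) := by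
  intro i hi i' hi' h
  simp only [Finset.coe_range, Set.mem_Iio, ← YoungDiagram.mem_iff_lt_colLen] at hi hi'
  simp only at h
  rcases lt_trichotomy i i' with hlt | rfl | hlt
  · have := S.entry_lt hlt hi'
    omega
  · rfl
  · have := S.entry_lt hlt hi
    omega

theorem card_col (S : RSSYT μ) (j : ℕ) : (S.col j).card = μ.colLen j := by
  rw [col, Finset.card_image_of_injOn (S.entry_injOn j), Finset.card_range]

theorem countGe_col (S : RSSYT μ) (j x : ℕ) :
    countGe (S.col j) x = ((Finset.range (μ.colLen j)).filter (x ≤ S.entry · j)).card := by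
  rw [countGe, col, Finset.filter_image, Finset.card_image_of_injOn]
  exact (S.entry_injOn j).mono (Finset.coe_subset.mpr (Finset.filter_subset _ _))

theorem le_entry_iff (S : RSSYT μ) {i j : ℕ} (h : (i, j) ∈ μ) (x : ℕ) :
    x ≤ S.entry i j ↔ i < countGe (S.col j) x := by
  rw [countGe_col, ← mem_iff_lt_card_of_isLowerSet]
  · simp [← YoungDiagram.mem_iff_lt_colLen, h]
  · intro i hi i' hi'
    simp only [Finset.mem_filter, Finset.mem_range, ← YoungDiagram.mem_iff_lt_colLen] at hi ⊢
    exact ⟨μ.up_left_mem hi'.le le_rfl hi.1, hi.2.trans (S.entry_lt hi' hi.1).le⟩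

theorem semistandard_col (S : RSSYT μ) : Semistandard S.col := by
  intro j x
  rw [countGe_col, countGe_col]
  refine Finset.card_le_card fun i => ?_
  simp only [Finset.mem_filter, Finset.mem_range, ← YoungDiagram.mem_iff_lt_colLen]
  exact fun h => ⟨μ.up_left_mem le_rfl (Nat.le_succ j) h.1, h.2.trans (S.row_weak i j h.1)⟩

theorem eq_of_col_eq {S S' : RSSYT μ} (h : S.col = S'.col) : S = S' := by
  ext i j
  by_cases hij : (i, j) ∈ μ
  · refine eq_of_forall_le_iff fun x => ?_
    rw [S.le_entry_iff hij, S'.le_entry_iff hij, h]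
  · rw [S.zeros i j hij, S'.zeros i j hij]

/-- Row `i` of a column receives its `(i + 1)`-st largest element, described as the greatest `x`
with more than `i` elements at least `x`. -/
theorem exists_of_semistandard {C : ℕ → Finset ℕ} (hC : Semistandard C)
    (hcard : ∀ j, (C j).card = μ.colLen j) : ∃ S : RSSYT μ, S.col = C := by
  have hmax : ∀ i j, (i, j) ∈ μ → ∃ y, ∀ x, x ≤ y ↔ i < countGe (C j) x := by
    intro i j hij
    have h0 : i < countGe (C j) 0 := by
      rw [countGe_zero, hcard]
      exact YoungDiagram.mem_iff_lt_colLen.mp hij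
    have hb : ∀ x, i < countGe (C j) x → x ≤ (C j).sup id := by
      intro x hx
      obtain ⟨y, hy⟩ := Finset.card_pos.mp (Nat.zero_lt_of_lt hx)
      rw [Finset.mem_filter] at hy
      exact hy.2.trans (Finset.le_sup (f := id) hy.1)
    refine ⟨Nat.findGreatest (fun x => i < countGe (C j) x) ((C j).sup id), fun x => ?_⟩
    constructor
    · intro hx
      have := Nat.findGreatest_spec (P := fun x => i < countGe (C j) x)
        (Nat.zero_le ((C j).sup id)) h0
      exact lt_of_lt_of_le this (countGe_antitone (C j) hx)
    · intro hx
      exact Nat.le_findGreatest (hb x hx) hx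
  choose! e he using hmax
  let S : RSSYT μ :=
    { entry := fun i j => if (i, j) ∈ μ then e i j else 0
      row_weak := fun i j h => by
        have h' := μ.up_left_mem le_rfl (Nat.le_succ j) h
        rw [if_pos h, if_pos h', he i j h']
        exact ((he i (j + 1) h _).mp le_rfl).trans_le (hC j _)
      col_strict := fun i j h => by
        have h' := μ.up_left_mem (Nat.le_succ i) le_rfl h
        rw [if_pos h, if_pos h', ← Nat.succ_le_iff, he i j h']
        have h1 := (he (i + 1) j h _).mp le_rfl
        have h2 := countGe_succ (C j) (e (i + 1) j)
        rw [Nat.succ_eq_add_one]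
        split_ifs at h2 <;> omega
      zeros := fun i j h => if_neg h }
  refine ⟨S, funext fun j => Finset.eq_of_subset_of_card_le (fun y hy => ?_) ?_⟩
  · obtain ⟨i, hi, rfl⟩ := Finset.mem_image.mp hy
    rw [Finset.mem_range, ← YoungDiagram.mem_iff_lt_colLen] at hi
    have h1 : S.entry i j = e i j := if_pos hi
    rw [h1]
    -- The count drops right after `e i j`, so `e i j` is an element of `C j`.
    have h2 := (he i j hi _).mp le_rfl
    have h3 := (he i j hi (e i j + 1)).not.mp (by omega)
    have h4 := countGe_succ (C j) (e i j)
    by_contra hc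
    rw [if_neg hc] at h4
    omega
  · rw [hcard, S.card_col]

theorem leftKeyCol_eq (S : RSSYT μ) (k : ℕ) : S.leftKeyCol k = keyCol S.col k := by
  rw [leftKeyCol, keyCol, triFold_eq_foldr]

theorem leftKey_eq (S : RSSYT μ) : S.leftKey = compOf (keyList (μ.rowLen 0) S.col) := by
  rw [leftKey, compOf, keyList, List.map_map, Finset.sum_range, ← List.sum_ofFn]
  congr 1
  rw [List.ofFn_eq_map, ← List.map_coe_finRange_eq_range, List.map_map]
  simp [leftKeyCol_eq, Function.comp_def]

/-! ### Letters that can be added to a box -/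

/-- The letters that may be added to box `(i, j)` of `S` below its entry. -/
def gap (S : RSSYT μ) (i j : ℕ) : Finset ℕ :=
  (Finset.range (S.entry i j)).filter fun k =>
    ((i, j + 1) ∈ μ → S.entry i (j + 1) ≤ k) ∧ ((i + 1, j) ∈ μ → S.entry (i + 1) j < k)

/-- Conditions on entries of `S` become conditions on counts in two columns. In particular, the
letter determines the row: box `i` must hold the lowest entry above `k`. -/
theorem mem_gap_iff (S : RSSYT μ) {i j : ℕ} (h : (i, j) ∈ μ) (k : ℕ) :
    k ∈ S.gap i j ↔ k ∉ S.col j ∧ countGe (S.col (j + 1)) (k + 1) ≤ i ∧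
      countGe (S.col j) (k + 1) = i + 1 := by
  have h1 : ((i, j + 1) ∈ μ → S.entry i (j + 1) ≤ k) ↔ countGe (S.col (j + 1)) (k + 1) ≤ i := by
    by_cases hr : (i, j + 1) ∈ μ
    · have := S.le_entry_iff hr (k + 1)
      simp only [hr, true_imp_iff]
      omega
    · have h1 := countGe_le_card (S.col (j + 1)) (k + 1)
      rw [S.card_col] at h1
      have h2 : ¬ i < μ.colLen (j + 1) := fun h => hr (YoungDiagram.mem_iff_lt_colLen.mpr h)
      simp only [hr, false_imp_iff, true_iff]
      omega
  have h2 : ((i + 1, j) ∈ μ → S.entry (i + 1) j < k) ↔ countGe (S.col j) k ≤ i + 1 := by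
    by_cases hr : (i + 1, j) ∈ μ
    · have := S.le_entry_iff hr k
      simp only [hr, true_imp_iff]
      omega
    · have h1 := countGe_le_card (S.col j) k
      rw [S.card_col] at h1
      have h2 : ¬ i + 1 < μ.colLen j := fun h => hr (YoungDiagram.mem_iff_lt_colLen.mpr h)
      simp only [hr, false_imp_iff, true_iff]
      omega
  have h3 := countGe_succ (S.col j) k
  rw [gap, Finset.mem_filter, h1, h2, Finset.mem_range, ← Nat.succ_le_iff, S.le_entry_iff h,
    Nat.succ_eq_add_one]
  split_ifs at h3 with hk
  · simp only [hk, not_true, false_and, iff_false]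
    omega
  · simp only [hk, not_false_eq_true, true_and]
    omega

theorem prod_cells (μ : YoungDiagram) {N : ℕ} (hN : μ.rowLen 0 ≤ N) (f : ℕ → ℕ → R) :
    ∏ c ∈ μ.cells, f c.1 c.2 = ∏ j ∈ Finset.range N, ∏ i ∈ Finset.range (μ.colLen j), f i j := by
  rw [Finset.prod_sigma']
  refine Finset.prod_nbij' (fun c => ⟨c.2, c.1⟩) (fun c => (c.2, c.1)) ?_ ?_ ?_ ?_ ?_
  · rintro ⟨i, j⟩ h
    rw [YoungDiagram.mem_cells] at h
    simp only [Finset.mem_sigma, Finset.mem_range]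
    refine ⟨lt_of_lt_of_le ?_ hN, YoungDiagram.mem_iff_lt_colLen.mp h⟩
    exact YoungDiagram.mem_iff_lt_rowLen.mp (μ.up_left_mem (Nat.zero_le i) le_rfl h)
  · rintro ⟨j, i⟩ h
    simp only [Finset.mem_sigma, Finset.mem_range] at h
    rw [YoungDiagram.mem_cells]
    exact YoungDiagram.mem_iff_lt_colLen.mpr h.2
  · rintro ⟨i, j⟩ _; rfl
  · rintro ⟨i, j⟩ _; rfl
  · rintro ⟨i, j⟩ _; rfl

theorem prod_boxWt (S : RSSYT μ) {n N : ℕ} (hN : μ.rowLen 0 ≤ N)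
    (hn : ∀ j, ∀ x ∈ S.col j, x < n) :
    ∏ c ∈ μ.cells, ((X (S.entry c.1 c.2) : R) * ∏ k ∈ S.gap c.1 c.2, (1 + beta * X k))
      = ∏ l ∈ Finset.range n, ∏ j ∈ Finset.range N, letterWt S.col l j := by
  rw [prod_cells μ hN fun i j => (X (S.entry i j) : R) * ∏ k ∈ S.gap i j, (1 + beta * X k),
    Finset.prod_comm]
  refine Finset.prod_congr rfl fun j _ => ?_
  rw [Finset.prod_mul_distrib]
  have h1 : ∏ i ∈ Finset.range (μ.colLen j), (X (S.entry i j) : R)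
      = ∏ l ∈ Finset.range n, if l ∈ S.col j then X l else 1 := by
    rw [← Finset.prod_filter, ← Finset.prod_image (g := fun i => S.entry i j)
      (f := fun l => (X l : R)) (S.entry_injOn j)]
    refine Finset.prod_congr ?_ fun _ _ => rfl
    ext x
    rw [Finset.mem_filter, Finset.mem_range]
    exact ⟨fun h => ⟨hn j x h, h⟩, fun h => h.2⟩
  have h2 : ∏ i ∈ Finset.range (μ.colLen j), ∏ k ∈ S.gap i j, (1 + beta * X k : R)
      = ∏ l ∈ Finset.range n, if l ∉ S.col j ∧
        countGe (S.col (j + 1)) (l + 1) < countGe (S.col j) (l + 1) then 1 + beta * X l else 1 := by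
    rw [← Finset.prod_filter, Finset.prod_sigma']
    -- The row of `l` is the last one whose entry exceeds `l`, hence the subtraction of one.
    refine Finset.prod_nbij' (fun p => p.2) (fun l => ⟨countGe (S.col j) (l + 1) - 1, l⟩)
      ?_ ?_ ?_ ?_ ?_
    · rintro ⟨i, k⟩ h
      simp only [Finset.mem_sigma, Finset.mem_range] at h
      have hm := YoungDiagram.mem_iff_lt_colLen.mpr h.1
      obtain ⟨a1, a2, a3⟩ := (S.mem_gap_iff hm k).mp h.2
      have hk : k < S.entry i j := Finset.mem_range.mp (Finset.mem_filter.mp h.2).1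
      have := hn j (S.entry i j) (Finset.mem_image.mpr ⟨i, Finset.mem_range.mpr h.1, rfl⟩)
      simp only [Finset.mem_filter, Finset.mem_range]
      exact ⟨hk.trans this, a1, by omega⟩
    · intro l h
      simp only [Finset.mem_filter, Finset.mem_range] at h
      obtain ⟨_, a1, a2⟩ := h
      have h3 := countGe_le_card (S.col j) (l + 1)
      rw [S.card_col] at h3
      simp only [Finset.mem_sigma, Finset.mem_range]
      have h4 : countGe (S.col j) (l + 1) - 1 < μ.colLen j := by omega
      refine ⟨h4, (S.mem_gap_iff (YoungDiagram.mem_iff_lt_colLen.mpr h4) l).mpr ⟨a1, ?_, ?_⟩⟩ <;>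
        omega
    · rintro ⟨i, k⟩ h
      simp only [Finset.mem_sigma, Finset.mem_range] at h
      obtain ⟨a1, a2, a3⟩ := (S.mem_gap_iff (YoungDiagram.mem_iff_lt_colLen.mpr h.1) k).mp h.2
      simp [a3]
    · intro l _
      rfl
    · intro p _
      rfl
  rw [h1, h2, ← Finset.prod_mul_distrib]
  refine Finset.prod_congr rfl fun l _ => ?_
  rw [letterWt]
  by_cases h : l ∈ S.col j <;> simp [h]

end RSSYT


/-! ### Set-valued tableaux -/

theorem colLen_sortedShape {α : Comp} {n : ℕ} (hn : ∀ k, n ≤ k → α k = 0) (j : ℕ) :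
    (sortedShape α).colLen j = ((Finset.range n).filter (j < α ·)).card := by
  set s := α.support.val.map α with hs
  set w := s.sort (· ≥ ·) with hw
  have h1 : (sortedShape α).colLen j
      = ((Finset.univ : Finset (Fin w.length)).filter fun i => j < w.get i).card := by
    rw [← Finset.card_range ((sortedShape α).colLen j)]
    refine (Finset.card_bij (fun i _ => i.1) ?_ (fun _ _ _ _ h => Fin.ext h) ?_).symm
    · intro i hi
      rw [Finset.mem_range, ← YoungDiagram.mem_iff_lt_colLen]
      exact YoungDiagram.mem_ofRowLens.mpr ⟨i.2, (Finset.mem_filter.mp hi).2⟩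
    · intro i hi
      rw [Finset.mem_range, ← YoungDiagram.mem_iff_lt_colLen] at hi
      obtain ⟨h, h'⟩ := YoungDiagram.mem_ofRowLens.mp hi
      exact ⟨⟨i, h⟩, by simpa using h', rfl⟩
  have h2 : (Finset.univ : Finset (Fin w.length)).val.map w.get = s := by
    rw [Fin.univ_val_map, List.ofFn_get, hw, Multiset.sort_eq]
  have h3 : ((Finset.univ : Finset (Fin w.length)).filter fun i => j < w.get i).card
      = s.countP (j < ·) := by
    rw [← h2, Multiset.countP_map]
    rfl
  rw [h1, h3, hs, Multiset.countP_map]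
  change (α.support.filter (j < α ·)).card = _
  congr 1
  ext k
  simp only [Finset.mem_filter, Finsupp.mem_support_iff, Finset.mem_range]
  have := hn k
  omega

variable {μ : YoungDiagram}

namespace RSVT

theorem le_L_entry (T : RSVT μ) {i j x : ℕ} (hx : x ∈ T.entry i j) : x ≤ T.L.entry i j :=
  Finset.le_sup (f := id) hx

theorem mem_gap (T : RSVT μ) {i j x : ℕ} (hx : x ∈ T.entry i j) (hne : x ≠ T.L.entry i j) :
    x ∈ T.L.gap i j := by
  rw [RSSYT.gap, Finset.mem_filter, Finset.mem_range]
  exact ⟨(T.le_L_entry hx).lt_of_ne hne, fun h => T.row_weak i j h x hx _ (T.sup_mem h),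
    fun h => T.col_strict i j h x hx _ (T.sup_mem h)⟩

theorem wt_degree (T : RSVT μ) : T.wt.degree = ∑ c ∈ μ.cells, (T.entry c.1 c.2).card := by
  simp [wt, map_sum]

theorem ex_eq (T : RSVT μ) : T.ex = ∑ c ∈ μ.cells, ((T.entry c.1 c.2).card - 1) := by
  have h : ∑ c ∈ μ.cells, (T.entry c.1 c.2).card
      = ∑ c ∈ μ.cells, ((T.entry c.1 c.2).card - 1) + μ.card := by
    rw [YoungDiagram.card, Finset.card_eq_sum_ones, ← Finset.sum_add_distrib]
    refine Finset.sum_congr rfl fun c hc => ?_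
    have := Finset.card_pos.mpr (T.nonempty c.1 c.2 ((μ.mem_cells _).mp hc))
    omega
  rw [ex, wt_degree, h, Nat.add_sub_cancel]

theorem term_eq_prod (T : RSVT μ) : beta ^ T.ex * monomial T.wt 1 = ∏ c ∈ μ.cells,
    ((X (T.L.entry c.1 c.2) : R) *
      ∏ k ∈ (T.entry c.1 c.2).erase (T.L.entry c.1 c.2), (beta * X k)) := by
  rw [ex_eq, ← Finset.prod_pow_eq_pow_sum, wt, monomial_sum_one, ← Finset.prod_mul_distrib]
  refine Finset.prod_congr rfl fun c hc => ?_
  have hm : T.L.entry c.1 c.2 ∈ T.entry c.1 c.2 := T.sup_mem ((μ.mem_cells _).mp hc)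
  rw [monomial_sum_one, Finset.prod_mul_distrib, Finset.prod_const, Finset.card_erase_of_mem hm]
  change _ * ∏ k ∈ _, X k = _
  rw [← Finset.mul_prod_erase _ _ hm]
  ring

/-- The set-valued tableau with `L(T) = S` whose further letters are given by `U`. -/
def ofGap (S : RSSYT μ) (U : μ.cells → Finset ℕ) : RSVT μ where
  -- Intersecting with the gap gives a valid tableau for every `U`, so no condition on `U` is
  -- needed.
  entry i j := if h : (i, j) ∈ μ then insert (S.entry i j) (U ⟨(i, j), h⟩ ∩ S.gap i j) else ∅
  nonempty i j h := by
    rw [dif_pos h]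
    exact Finset.insert_nonempty _ _
  row_weak i j h x hx y hy := by
    have h' := μ.up_left_mem le_rfl (Nat.le_succ j) h
    rw [dif_pos h', Finset.mem_insert] at hx
    rw [dif_pos h, Finset.mem_insert] at hy
    have h1 : y ≤ S.entry i (j + 1) := by
      rcases hy with rfl | hy
      · exact le_rfl
      · exact (Finset.mem_range.mp (Finset.mem_filter.mp (Finset.mem_inter.mp hy).2).1).le
    refine h1.trans ?_
    rcases hx with rfl | hx
    · exact S.row_weak i j h
    · exact (Finset.mem_filter.mp (Finset.mem_inter.mp hx).2).2.1 h
  col_strict i j h x hx y hy := by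
    have h' := μ.up_left_mem (Nat.le_succ i) le_rfl h
    rw [dif_pos h', Finset.mem_insert] at hx
    rw [dif_pos h, Finset.mem_insert] at hy
    have h1 : y ≤ S.entry (i + 1) j := by
      rcases hy with rfl | hy
      · exact le_rfl
      · exact (Finset.mem_range.mp (Finset.mem_filter.mp (Finset.mem_inter.mp hy).2).1).le
    refine h1.trans_lt ?_
    rcases hx with rfl | hx
    · exact S.col_strict i j h
    · exact (Finset.mem_filter.mp (Finset.mem_inter.mp hx).2).2.2 h
  empty i j h := dif_neg h

theorem ofGap_entry (S : RSSYT μ) (U : μ.cells → Finset ℕ) {i j : ℕ} (h : (i, j) ∈ μ) :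
    (ofGap S U).entry i j = insert (S.entry i j) (U ⟨(i, j), h⟩ ∩ S.gap i j) := dif_pos h

theorem L_ofGap (S : RSSYT μ) (U : μ.cells → Finset ℕ) : (ofGap S U).L = S := by
  ext i j
  change ((ofGap S U).entry i j).sup id = _
  by_cases h : (i, j) ∈ μ
  · rw [ofGap_entry S U h, Finset.sup_insert, id, sup_eq_left]
    refine Finset.sup_le fun x hx => ?_
    exact (Finset.mem_range.mp (Finset.mem_filter.mp (Finset.mem_inter.mp hx).2).1).le
  · rw [(ofGap S U).empty i j h, S.zeros i j h]
    rfl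

/-- Expanding the product over the boxes selects a subset of each gap. Each gap involves only `S`,
so the selections are independent and correspond to the tableaux over `S`. -/
theorem sum_fiber (S : RSSYT μ) (t : Finset (RSVT μ)) (ht : ∀ T, T ∈ t ↔ T.L = S) :
    ∑ T ∈ t, beta ^ T.ex * monomial T.wt 1
      = ∏ c ∈ μ.cells, ((X (S.entry c.1 c.2) : R) * ∏ k ∈ S.gap c.1 c.2, (1 + beta * X k)) := by
  rw [← Finset.prod_coe_sort]
  simp only [Finset.prod_one_add, Finset.mul_sum]
  rw [Finset.prod_univ_sum]
  have hS : ∀ i j, S.entry i j ∉ S.gap i j := fun i j h =>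
    lt_irrefl _ (Finset.mem_range.mp (Finset.mem_filter.mp h).1)
  refine Finset.sum_nbij' (fun T c => (T.entry c.1.1 c.1.2).erase (S.entry c.1.1 c.1.2))
    (fun U => ofGap S U) ?_ ?_ ?_ ?_ ?_
  · intro T hT
    obtain rfl := (ht T).mp hT
    rw [Fintype.mem_piFinset]
    intro c
    rw [Finset.mem_powerset]
    intro x hx
    rw [Finset.mem_erase] at hx
    exact T.mem_gap hx.2 hx.1
  · intro U _
    exact (ht _).mpr (L_ofGap S U)
  · intro T hT
    obtain rfl := (ht T).mp hT
    ext i j x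
    by_cases h : (i, j) ∈ μ
    · rw [ofGap_entry _ _ h, Finset.mem_insert, Finset.mem_inter, Finset.mem_erase]
      constructor
      · rintro (rfl | hx)
        · exact T.sup_mem h
        · exact hx.1.2
      · intro hx
        by_cases hne : x = T.L.entry i j
        · exact .inl hne
        · exact .inr ⟨⟨hne, hx⟩, T.mem_gap hx hne⟩
    · rw [(ofGap _ _).empty i j h, T.empty i j h]
  · intro U hU
    rw [Fintype.mem_piFinset] at hU
    funext c
    have h1 := Finset.mem_powerset.mp (hU c)
    change ((ofGap S U).entry c.1.1 c.1.2).erase _ = _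
    rw [ofGap_entry S U (i := c.1.1) (j := c.1.2) c.2, Finset.inter_eq_left.mpr h1,
      Finset.erase_insert fun h => hS _ _ (h1 h)]
  · intro T hT
    obtain rfl := (ht T).mp hT
    rw [term_eq_prod, ← Finset.prod_coe_sort]

end RSVT

/-- The columns of `S` as a set of pairs. -/
def RSSYT.pairs (S : RSSYT μ) : Finset (ℕ × ℕ) :=
  μ.cells.image fun c => (S.entry c.1 c.2, c.2)

theorem RSSYT.cols_pairs (S : RSSYT μ) : cols S.pairs = S.col := by
  funext j
  ext l
  rw [mem_cols, RSSYT.pairs, RSSYT.col, Finset.mem_image, Finset.mem_image]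
  constructor
  · rintro ⟨⟨i, j'⟩, h, e⟩
    simp only [Prod.mk.injEq] at e
    obtain ⟨rfl, rfl⟩ := e
    exact ⟨i, Finset.mem_range.mpr (YoungDiagram.mem_iff_lt_colLen.mp ((μ.mem_cells _).mp h)), rfl⟩
  · rintro ⟨i, h, rfl⟩
    exact ⟨(i, j), (μ.mem_cells _).mpr (YoungDiagram.mem_iff_lt_colLen.mpr (Finset.mem_range.mp h)),
      rfl⟩

/-- Column `0` is its own key column, so its entries lie in the support of the left key; going down
in the order never leaves `[0, n)`. This bounds all letters and yields finiteness. -/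
theorem RSSYT.entry_lt_of_compLE {α : Comp} {n : ℕ} (hn : ∀ k, n ≤ k → α k = 0) (S : RSSYT μ)
    (h : CompLE S.leftKey α) {i j : ℕ} (hij : (i, j) ∈ μ) : S.entry i j < n := by
  have h0 : (i, 0) ∈ μ := μ.up_left_mem le_rfl (Nat.zero_le j) hij
  have h1 : S.entry i j ≤ S.entry i 0 := by
    clear h0
    induction j with
    | zero => exact le_rfl
    | succ j ih =>
      exact (S.row_weak i j hij).trans (ih (μ.up_left_mem le_rfl (Nat.le_succ j) hij))
  have h2 : S.entry i 0 ∈ keyCol S.col 0 :=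
    Finset.mem_image.mpr ⟨i, Finset.mem_range.mpr (YoungDiagram.mem_iff_lt_colLen.mp h0), rfl⟩
  have hr : 0 < μ.rowLen 0 :=
    YoungDiagram.mem_iff_lt_rowLen.mp (μ.up_left_mem (Nat.zero_le i) le_rfl h0)
  rw [mem_keyCol_iff _ hr, ← S.leftKey_eq] at h2
  by_contra hc
  have := SwapLE.zero_of_ge (compLE_iff_swapLE.mp h) hn (S.entry i 0) (by omega)
  omega

theorem RSVT.finite_of_compLE (μ : YoungDiagram) (α : Comp) {n : ℕ}
    (hn : ∀ k, n ≤ k → α k = 0) : {T : RSVT μ | CompLE T.L.leftKey α}.Finite := by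
  refine Set.Finite.of_injOn (f := fun T (c : μ.cells) => T.entry c.1.1 c.1.2)
    (t := (Fintype.piFinset fun _ : μ.cells => (Finset.range n).powerset : Set _)) ?_ ?_
    (Finset.finite_toSet _)
  · intro T hT
    rw [Finset.mem_coe, Fintype.mem_piFinset]
    intro c
    rw [Finset.mem_powerset]
    intro x hx
    rw [Finset.mem_range]
    exact (T.le_L_entry hx).trans_lt (T.L.entry_lt_of_compLE hn hT c.2)
  · intro T _ T' _ h
    ext i j x
    by_cases hij : (i, j) ∈ μ
    · have := congrFun h ⟨(i, j), hij⟩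
      simp only at this
      rw [this]
    · rw [T.empty i j hij, T'.empty i j hij]

/-! ### Comparison of the sums over tableaux and over sets of pairs -/

/-- The columns of a tableau with key below `α` have the lengths prescribed by `α`. -/
theorem card_cols_of_compLE {α : Comp} {n N : ℕ} (hn : ∀ k, n ≤ k → α k = 0)
    {C : ℕ → Finset ℕ} (hC : Semistandard C) (h : CompLE (compOf (keyList N C)) α) {j : ℕ}
    (hj : j < N) : (C j).card = ((Finset.range n).filter (j < α ·)).card := by
  have h' := compLE_iff_swapLE.mp h
  rw [← hC.card_keyCol, ← h'.card_eq hn j]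
  congr 1
  ext c
  rw [mem_keyCol_iff C hj, Finset.mem_filter, Finset.mem_range]
  refine ⟨fun hc => ⟨?_, hc⟩, fun hc => hc.2⟩
  by_contra hcn
  have := h'.zero_of_ge hn c (not_lt.mp hcn)
  omega

theorem sum_rsvt_eq {α : Comp} {n : ℕ} (hn : ∀ k, n ≤ k → α k = 0)
    (t : Finset (RSVT (sortedShape α))) (ht : ∀ T, T ∈ t ↔ CompLE T.L.leftKey α) :
    ∑ T ∈ t, beta ^ T.ex * monomial T.wt 1
      = ∑ M ∈ (Finset.range n ×ˢ Finset.range ((sortedShape α).rowLen 0)).powerset,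
        tabTerm n ((sortedShape α).rowLen 0) 0 (keyLE α) (cols M) := by
  classical
  set N := (sortedShape α).rowLen 0 with hN
  have hcell : ∀ i j, (i, j) ∈ sortedShape α → j < N := fun i j h =>
    YoungDiagram.mem_iff_lt_rowLen.mp ((sortedShape α).up_left_mem (Nat.zero_le i) le_rfl h)
  rw [← Finset.sum_fiberwise_of_maps_to (g := fun T : RSVT (sortedShape α) => T.L.pairs)
    (t := (Finset.range n ×ˢ Finset.range N).powerset)]
  swap
  · intro T hT
    rw [Finset.mem_powerset]
    intro p hp
    obtain ⟨⟨i, j⟩, hc, rfl⟩ := Finset.mem_image.mp hp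
    rw [YoungDiagram.mem_cells] at hc
    rw [Finset.mem_product, Finset.mem_range, Finset.mem_range]
    exact ⟨T.L.entry_lt_of_compLE hn ((ht T).mp hT) hc, hcell i j hc⟩
  refine Finset.sum_congr rfl fun M hM => ?_
  have hMb : ∀ l j, l ∈ cols M j → l < n ∧ j < N := fun l j h => by
    simpa using Finset.mem_powerset.mp hM (mem_cols.mp h)
  by_cases hgood : Semistandard (cols M) ∧ CompLE (compOf (keyList N (cols M))) α
  · obtain ⟨hS, hK⟩ := hgood
    -- The sum over `M` prescribes no shape; the key condition forces it to be `α⁺`.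
    have hcard : ∀ j, (cols M j).card = (sortedShape α).colLen j := by
      intro j
      by_cases hj : j < N
      · rw [card_cols_of_compLE hn hS hK hj, colLen_sortedShape hn]
      · have h1 : cols M j = ∅ := Finset.eq_empty_of_forall_notMem fun x hx => hj (hMb x j hx).2
        have h2 : (sortedShape α).colLen j = 0 := by
          by_contra hc
          exact hj (hcell 0 j (YoungDiagram.mem_iff_lt_colLen.mpr (Nat.pos_of_ne_zero hc)))
        rw [h1, h2, Finset.card_empty]
    obtain ⟨S, hSc⟩ := RSSYT.exists_of_semistandard hS hcard
    rw [RSVT.sum_fiber S, tabTerm, if_pos hS, keyLE, if_pos hK, mul_one, ← Finset.range_eq_Ico,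
      ← hSc, RSSYT.prod_boxWt S le_rfl]
    · intro j x hx
      rw [hSc] at hx
      exact (hMb x j hx).1
    · intro T
      rw [Finset.mem_filter, ht]
      constructor
      · rintro ⟨-, h⟩
        refine RSSYT.eq_of_col_eq ?_
        rw [← RSSYT.cols_pairs, h, hSc]
      · intro h
        rw [h, S.leftKey_eq, hSc]
        refine ⟨hK, ?_⟩
        ext ⟨l, j⟩
        rw [← mem_cols, ← mem_cols, S.cols_pairs, hSc]
  · have h0 : tabTerm n N 0 (keyLE α) (cols M) = 0 := by
      rw [tabTerm]
      split_ifs with hS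
      · rw [keyLE, if_neg fun hK => hgood ⟨hS, hK⟩, mul_zero]
      · rfl
    rw [h0]
    refine Finset.sum_eq_zero fun T hT => absurd ?_ hgood
    obtain ⟨h1, rfl⟩ := Finset.mem_filter.mp hT
    rw [T.L.cols_pairs]
    exact ⟨T.L.semistandard_col, T.L.leftKey_eq ▸ (ht T).mp h1⟩

end Lascoux

theorem theorem1p1 (α : Lascoux.Comp) :
    {T : Lascoux.RSVT (Lascoux.sortedShape α) | Lascoux.CompLE T.L.leftKey α}.Finite ∧
    Lascoux.lascoux α =
      ∑ᶠ (T : Lascoux.RSVT (Lascoux.sortedShape α)) (_ : Lascoux.CompLE T.L.leftKey α),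
        Lascoux.beta ^ T.ex * MvPolynomial.monomial T.wt 1 := by
  obtain ⟨n, hn⟩ : ∃ n, ∀ k, n ≤ k → α k = 0 := by
    refine ⟨α.support.sup id + 1, fun k hk => ?_⟩
    by_contra hc
    have : k ≤ α.support.sup id := Finset.le_sup (f := id) (Finsupp.mem_support_iff.mpr hc)
    omega
  have hfin := Lascoux.RSVT.finite_of_compLE (Lascoux.sortedShape α) α hn
  refine ⟨hfin, ?_⟩
  have hN : ∀ k, α k ≤ (Lascoux.sortedShape α).rowLen 0 := by
    intro k
    by_contra hc
    have hkn : k < n := by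
      by_contra h
      have := hn k (not_lt.mp h)
      omega
    -- A part larger than the first row would give a box in the column just beyond that row.
    have h : 0 < (Lascoux.sortedShape α).colLen ((Lascoux.sortedShape α).rowLen 0) := by
      rw [Lascoux.colLen_sortedShape hn]
      exact Finset.card_pos.mpr ⟨k, by simp [hkn]; omega⟩
    rw [← YoungDiagram.mem_iff_lt_colLen, YoungDiagram.mem_iff_lt_rowLen] at h
    exact lt_irrefl _ h
  rw [Lascoux.lascoux_eq_sum α hn hN, ← Lascoux.sum_rsvt_eq hn hfin.toFinset (by simp)]
  exact (finsum_mem_eq_finite_toFinset_sum _ hfin).symm
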